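/- Let $G$ be a compact, connected matrix Lie group, $G \subset GL(n,\mathbb C)$, with Lie algebra $\mathfrak g$. On $\mathbb R^{1+3}$, with Cartesian coordinates $(t,x)=(x^0,x^1,x^2,x^3)$ and the Minkowski metric of signature $(-+++)$, let $$\mathbb D=\{(t,x)\in\mathbb R^{1+3} : |x|\le t+1,\ |x|\le 1-t\},\qquad \partial^-\mathbb D=\{(t,x)\in\mathbb D : |x|=t+1\},\qquad p=(-1,0).$$ For a smooth $\mathfrak g$-valued 1-form $A\in\Omega^1(\mathbb D;\mathfrak g)$ (smooth up to the boundary) let $d_A\omega=d\omega+[A,\omega]$, where $[A,\omega]=A\wedge\omega-(-1)^k\omega\wedge A$ for a $k$-form $\omega$, let $F_A=dA+\tfrac12[A,A]$ be the curvature and let $d_A^*=\star d_A\star$, where $\star$ is the Hodge star of the Minkowski metric. Let $G^0(\mathbb D,p)=\{\mathbf U\in C^\infty(\mathbb D;G):\mathbf U(p)=\mathrm{id}\}$. Write $A\sim B$ in $\mathbb D$ if there is $\mathbf U\in G^0(\mathbb D,p)$ such that $$B=\mathbf U^{-1}d\mathbf U+\mathbf U^{-1}A\,\mathbf U \qquad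 (*)$$ holds in $\mathbb D$, and write $A\sim B$ near $\partial^-\mathbb D$ if there are $\mathbf U\in G^0(\mathbb D,p)$ and a neighbourhood $\mathcal U$ of $\partial^-\mathbb D$ such that $(*)$ holds in $\mathcal U\cap\mathbb D$. Suppose that $A,B\in\Omega^1(\mathbb D;\mathfrak g)$ solve the Yang--Mills equations $d_A^*F_A=0$ and $d_B^*F_B=0$ in $\mathbb D$, and that $A\sim B$ near $\partial^-\mathbb D$. Then $A\sim B$ in $\mathbb D$. -/

import Mathlib

open scoped ContDiff Matrix.Norms.L2Operator

namespace YangMills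

open Set

noncomputable section

/-! ### Minkowski space and the causal diamond -/

/-- Space-time `ℝ^{1+3}`; a point is `(t, x)` and `‖x‖` is the Euclidean norm of `x ∈ ℝ³`. -/
abbrev Spacetime : Type := ℝ × EuclideanSpace ℝ (Fin 3)

/-- The closed causal diamond `{(t, x) : |x| ≤ t + 1, |x| ≤ 1 - t}`. -/
def diamond : Set Spacetime := {z | ‖z.2‖ ≤ z.1 + 1 ∧ ‖z.2‖ ≤ 1 - z.1}

/-- The lower boundary `{(t, x) ∈ 𝔻 : |x| = t + 1}`. -/
def lowerBoundary : Set Spacetime := {z | z ∈ diamond ∧ ‖z.2‖ = z.1 + 1}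

/-- The bottom tip `p = (-1, 0)` of the diamond. -/
def basePoint : Spacetime := (-1, 0)

/-- The Cartesian coordinates `(x⁰, x¹, x², x³) = (t, x)`. -/
def coords (z : Spacetime) : Fin 4 → ℝ := Fin.cons z.1 (fun j => z.2 j)

/-- The coordinate vectors `∂_0, ∂_1, ∂_2, ∂_3`. -/
def coordVec : Fin 4 → Spacetime := Fin.cons (1, 0) (fun j => (0, EuclideanSpace.single j 1))

/-- The diagonal entries `g^{αα}` of the Minkowski metric, of signature `(- + + +)`. -/
def metricDiag : Fin 4 → ℝ := Fin.cons (-1) (fun _ => 1)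

/-- The volume form `dx⁰ ∧ dx¹ ∧ dx² ∧ dx³`. -/
def vol (w : Fin 4 → Spacetime) : ℝ := Matrix.det (Matrix.of fun a b => coords (w a) b)

/-! ### Smoothness on the closed diamond -/

/-- `f` is smooth on the set `s`: it is the restriction to `s` of a smooth map defined on an open
neighbourhood of `s`. -/
def SmoothOn {F : Type*} [NormedAddCommGroup F] [NormedSpace ℝ F]
    (s : Set Spacetime) (f : Spacetime → F) : Prop :=
  ∃ (O : Set Spacetime) (g : Spacetime → F),
    IsOpen O ∧ s ⊆ O ∧ ContDiffOn ℝ ∞ g O ∧ EqOn f g s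

/-! ### The Hodge star -/

section HodgeStar

variable {F : Type*} [NormedAddCommGroup F] [NormedSpace ℝ F]

theorem coords_add (z w : Spacetime) : coords (z + w) = coords z + coords w := by
  ext a
  refine Fin.cases ?_ (fun j => ?_) a <;> simp [coords]

theorem coords_smul (c : ℝ) (z : Spacetime) : coords (c • z) = c • coords z := by
  ext a
  refine Fin.cases ?_ (fun j => ?_) a <;> simp [coords]

theorem continuous_coords : Continuous coords := by
  refine continuous_pi fun a => ?_
  refine Fin.cases ?_ (fun j => ?_) a
  · simpa [coords] using continuous_fst
  · simp only [coords, Fin.cons_succ]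
    fun_prop

/-- The `k + m` vectors `u_1, …, u_k, v_1, …, v_m`, with `k + m = 4`, as a family over `Fin 4`. -/
def joinVec {k m : ℕ} (h : k + m = 4) (u : Fin k → Spacetime) (v : Fin m → Spacetime) :
    Fin 4 → Spacetime :=
  fun a => Sum.elim u v ((finSumFinEquiv.trans (finCongr h)).symm a)

theorem joinVec_update {k m : ℕ} (h : k + m = 4) (u : Fin k → Spacetime) [DecidableEq (Fin m)]
    (v : Fin m → Spacetime) (i : Fin m) (x : Spacetime) :
    joinVec h u (Function.update v i x) =
      Function.update (joinVec h u v) (finSumFinEquiv.trans (finCongr h) (Sum.inr i)) x := by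
  ext1 a
  obtain ⟨b, rfl⟩ := (finSumFinEquiv.trans (finCongr h)).surjective a
  simp only [joinVec, Equiv.symm_apply_apply, Function.update_apply,
    (finSumFinEquiv.trans (finCongr h)).injective.eq_iff]
  rcases b with b | b <;> simp [Function.update_apply]

theorem vol_update (w : Fin 4 → Spacetime) (a : Fin 4) (x : Spacetime) :
    vol (Function.update w a x) =
      (Matrix.updateRow (Matrix.of fun a b => coords (w a) b) a (coords x)).det := by
  unfold vol
  congr 1
  ext b c
  by_cases hb : b = a
  · subst hb; simp
  · simp [hb]

/-- The contraction `vol(u_1, …, u_k, ·, …, ·)` of the volume form, an `m`-form. -/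
def volContract {k m : ℕ} (h : k + m = 4) (u : Fin k → Spacetime) :
    Spacetime [⋀^Fin m]→L[ℝ] ℝ where
  toFun v := vol (joinVec h u v)
  map_update_add' v i x y := by
    simp only [joinVec_update, vol_update, coords_add, Matrix.det_updateRow_add]
  map_update_smul' v i c x := by
    simp only [joinVec_update, vol_update, coords_smul, Matrix.det_updateRow_smul, smul_eq_mul]
  map_eq_zero_of_eq' v i j hv hij := by
    refine Matrix.det_zero_of_row_eq (i := finSumFinEquiv.trans (finCongr h) (Sum.inr i))
      (j := finSumFinEquiv.trans (finCongr h) (Sum.inr j)) (by simpa using hij) ?_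
    ext b
    simp only [Matrix.of_apply, joinVec, Equiv.symm_apply_apply, Sum.elim_inr, hv]
  cont := by
    refine Continuous.matrix_det (continuous_matrix fun a b => ?_)
    refine (continuous_apply b).comp (continuous_coords.comp ?_)
    change Continuous fun v : Fin m → Spacetime =>
      Sum.elim u v ((finSumFinEquiv.trans (finCongr h)).symm a)
    rcases (finSumFinEquiv.trans (finCongr h)).symm a with c | c
    · exact continuous_const
    · exact continuous_apply c

/-- The Hodge star of a `k`-form, with `k + m = 4`:
`⋆η = (1/k!) ∑ g^{i₁i₁} ⋯ g^{i_k i_k} η(∂_{i₁}, …, ∂_{i_k}) vol(∂_{i₁}, …, ∂_{i_k}, ·)`. It is the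
linear map with `ξ ∧ ⋆η = ⟨ξ, η⟩ vol`. -/
def hodgeStar {k m : ℕ} (h : k + m = 4) (η : Spacetime [⋀^Fin k]→L[ℝ] F) :
    Spacetime [⋀^Fin m]→L[ℝ] F :=
  ((k.factorial : ℝ)⁻¹) • ∑ i : Fin k → Fin 4, (∏ a, metricDiag (i a)) •
    (ContinuousLinearMap.toSpanSingleton ℝ (η fun a => coordVec (i a))).compContinuousAlternatingMap
      (volContract h fun a => coordVec (i a))

end HodgeStar

/-! ### Matrix-valued forms, covariant derivative and the Yang–Mills equations -/

section Forms

variable {n : ℕ}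

/-- Complex `n × n` matrices. -/
abbrev Mat (n : ℕ) : Type := Matrix (Fin n) (Fin n) ℂ

/-- The commutator `X ↦ (Y ↦ X Y - Y X)`. -/
def matComm (n : ℕ) : Mat n →L[ℝ] Mat n →L[ℝ] Mat n :=
  ContinuousLinearMap.mul ℝ (Mat n) - (ContinuousLinearMap.mul ℝ (Mat n)).flip

/-- The pairing `[a, η] = a ∧ η - (-1)^k η ∧ a` of a 1-form with a `k`-form at a point, that is,
`[a, η](v_0, …, v_k) = ∑ (-1)^i [a(v_i), η(v_0, …, v_{i-1}, v_{i+1}, …, v_k)]`. -/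
def formBracket {k : ℕ} (a : Spacetime →L[ℝ] Mat n) (η : Spacetime [⋀^Fin k]→L[ℝ] Mat n) :
    Spacetime [⋀^Fin (k + 1)]→L[ℝ] Mat n :=
  ContinuousAlternatingMap.alternatizeUncurryFin <| LinearMap.toContinuousLinearMap
    { toFun := fun v => (matComm n (a v)).compContinuousAlternatingMap η
      map_add' := fun v w => by ext; simp
      map_smul' := fun c v => by ext; simp }

/-- A linear map viewed as an alternating map of one variable. -/
def asForm (a : Spacetime →L[ℝ] Mat n) : Spacetime [⋀^Fin 1]→L[ℝ] Mat n :=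
  ContinuousAlternatingMap.ofSubsingleton ℝ Spacetime (Mat n) 0 a

/-- The covariant derivative `d_A η = dη + [A, η]` on the set `s`. -/
def covDeriv {k : ℕ} (s : Set Spacetime) (A : Spacetime → Spacetime →L[ℝ] Mat n)
    (η : Spacetime → Spacetime [⋀^Fin k]→L[ℝ] Mat n) (z : Spacetime) :
    Spacetime [⋀^Fin (k + 1)]→L[ℝ] Mat n :=
  extDerivWithin η s z + formBracket (A z) (η z)

/-- The curvature `F_A = dA + ½ [A, A]` on the set `s`. -/
def curvature (s : Set Spacetime) (A : Spacetime → Spacetime →L[ℝ] Mat n) (z : Spacetime) :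
    Spacetime [⋀^Fin 2]→L[ℝ] Mat n :=
  extDerivWithin (fun y => asForm (A y)) s z + (2⁻¹ : ℝ) • formBracket (A z) (asForm (A z))

/-- The formal adjoint `d_A^* = ⋆ d_A ⋆` acting on 2-forms on the set `s`. -/
def covCoderiv (s : Set Spacetime) (A : Spacetime → Spacetime →L[ℝ] Mat n)
    (η : Spacetime → Spacetime [⋀^Fin 2]→L[ℝ] Mat n) (z : Spacetime) :
    Spacetime [⋀^Fin 1]→L[ℝ] Mat n :=
  hodgeStar (k := 3) (m := 1) rfl
    (covDeriv s A (fun y => hodgeStar (k := 2) (m := 2) rfl (η y)) z)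

/-- `A` solves the Yang–Mills equations `d_A^* F_A = 0` in the diamond. -/
def SolvesYangMills (A : Spacetime → Spacetime →L[ℝ] Mat n) : Prop :=
  ∀ z ∈ diamond, covCoderiv diamond A (curvature diamond A) z = 0

end Forms

/-! ### Connections and gauge equivalence -/

section Gauge

variable {n : ℕ}

/-- The Lie algebra of a closed matrix group `G`: the matrices `X` with `exp (t X) ∈ G` for all
real `t`. -/
def lieAlg (G : Subgroup (Matrix.GeneralLinearGroup (Fin n) ℂ)) : Set (Mat n) :=
  {X | ∀ t : ℝ, ∃ g ∈ G, (g : Mat n) = NormedSpace.exp (t • X)}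

/-- `A ∈ Ω¹(𝔻; 𝔤)`: a smooth 1-form on the diamond with values in the Lie algebra of `G`. -/
def IsConnection (G : Subgroup (Matrix.GeneralLinearGroup (Fin n) ℂ)) (A : Spacetime → Spacetime →L[ℝ] Mat n) : Prop :=
  SmoothOn diamond A ∧ ∀ z ∈ diamond, ∀ v, A z v ∈ lieAlg G

/-- `U ∈ G⁰(𝔻, p)`: a smooth map from the diamond to `G` with `U(p) = id`. -/
def IsPointedGauge (G : Subgroup (Matrix.GeneralLinearGroup (Fin n) ℂ)) (U : Spacetime → Matrix.GeneralLinearGroup (Fin n) ℂ) : Prop :=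
  SmoothOn diamond (fun z => (U z : Mat n)) ∧ (∀ z ∈ diamond, U z ∈ G) ∧ U basePoint = 1

/-- `B = U⁻¹ dU + U⁻¹ A U` at the point `z` of the diamond. -/
def GaugeRelatedAt (U : Spacetime → Matrix.GeneralLinearGroup (Fin n) ℂ) (A B : Spacetime → Spacetime →L[ℝ] Mat n)
    (z : Spacetime) : Prop :=
  ∀ v, B z v =
    ((U z)⁻¹ : Matrix.GeneralLinearGroup (Fin n) ℂ) * fderivWithin ℝ (fun y => (U y : Mat n)) diamond z v
      + ((U z)⁻¹ : Matrix.GeneralLinearGroup (Fin n) ℂ) * A z v * (U z : Mat n)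

/-- `A ∼ B` in the diamond. -/
def GaugeEquiv (G : Subgroup (Matrix.GeneralLinearGroup (Fin n) ℂ)) (A B : Spacetime → Spacetime →L[ℝ] Mat n) : Prop :=
  ∃ U, IsPointedGauge G U ∧ ∀ z ∈ diamond, GaugeRelatedAt U A B z

/-- `A ∼ B` near the lower boundary of the diamond. -/
def GaugeEquivNearLower (G : Subgroup (Matrix.GeneralLinearGroup (Fin n) ℂ))
    (A B : Spacetime → Spacetime →L[ℝ] Mat n) : Prop :=
  ∃ U, IsPointedGauge G U ∧ ∃ N : Set Spacetime, IsOpen N ∧ lowerBoundary ⊆ N ∧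
    ∀ z ∈ N ∩ diamond, GaugeRelatedAt U A B z

end Gauge

end

end YangMills

namespace YangMills

open Set

open scoped Interval

/-! ### Linear ordinary differential equations depending smoothly on a parameter -/

section LinearODE

variable {Z F : Type*} [NormedAddCommGroup F] [NormedSpace ℝ F]

/-! Multiplied on the left by U, the gauge relation becomes linear: D_μ U := ∂_μ U + A_μ U - U B_μ =
0. So U has to be parallel for the connection that acts by A on the left and by B on the right
(`gaugeRelatedAt_iff`).

The given gauge U₀ is parallel only near the lower boundary. It is kept there and continued into the
diamond along lines parallel to the time axis by solving D_0 U = 0 (`exists_temporal_intertwiner`).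
This equation is a linear ODE, so its solution exists for all times and is smooth in all variables
(`exists_contDiff_linearODE_solution`). A Grönwall estimate for the distance to the compact set G
keeps U in G (`mem_matrixSet_of_hasDerivAt`).

It remains to show that a_i = D_i U vanishes. Put f_{μν} = F^A_{μν} U - U F^B_{μν}, which equals
[D_μ, D_ν] U (`twistCurv_eq`). Since D_0 U = 0, this gives D_0 a_i = f_{0i}. By the Leibniz rule,
D_ρ f_{μν} = (D_ρ F^A_{μν}) U - U (D_ρ F^B_{μν}) plus terms of order zero in D_ρ U. The Yang–Mills
equations and the Bianchi identities for A and B therefore turn into Maxwell's equations for f, with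
sources linear and of order zero in (a, f).

Thus (a, f) solves a closed homogeneous symmetric hyperbolic system of speed at most one and
vanishes near the lower boundary. A weighted energy estimate (`eq_zero_of_symmetricHyperbolic`)
forces it to vanish in the open diamond (`twistD_eq_zero`), and continuity reaches the closed one.
Neither A nor B is put into a special gauge: the temporal condition is imposed on U alone. -/

/-- The terms of the Picard series of the linear equation `∂_s Y = L(s, z) Y`, `Y(0) = y₀`. -/
noncomputable def picardTerm (L : ℝ × Z → F →L[ℝ] F) (y₀ : F) : ℕ → ℝ → Z → F
  | 0 => fun _ _ => y₀
  | k + 1 => fun s z => ∫ r in (0 : ℝ)..s, L (r, z) (picardTerm L y₀ k r z)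

theorem continuous_picardTerm [TopologicalSpace Z] [FirstCountableTopology Z]
    {L : ℝ × Z → F →L[ℝ] F} (hL : Continuous L) (y₀ : F)
    (k : ℕ) : Continuous fun p : ℝ × Z => picardTerm L y₀ k p.1 p.2 := by
  induction k with
  | zero => exact continuous_const
  | succ k ih =>
    simp only [picardTerm]
    refine intervalIntegral.continuous_parametric_intervalIntegral_of_continuous
      (f := fun (p : ℝ × Z) r => L (r, p.2) (picardTerm L y₀ k r p.2)) ?_ continuous_fst
    have h1 : Continuous fun q : (ℝ × Z) × ℝ => (q.2, q.1.2) := by fun_prop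
    exact (hL.comp h1).clm_apply (ih.comp h1)

/-- Each integration contributes a factor M, and integrating |r|^k repeatedly builds up the
factorial. The bounds are summable in k, uniformly for bounded s. -/
theorem norm_picardTerm_le {L : ℝ × Z → F →L[ℝ] F} (y₀ : F) {M R : ℝ} (hM : 0 ≤ M) {z : Z}
    (hLM : ∀ s, |s| ≤ R → ‖L (s, z)‖ ≤ M) (k : ℕ) {s : ℝ} (hs : |s| ≤ R) :
    ‖picardTerm L y₀ k s z‖ ≤ ‖y₀‖ * (M ^ k / k.factorial) * |s| ^ k := by
  induction k generalizing s with
  | zero => simp [picardTerm]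
  | succ k ih =>
    have hbound : ∀ r ∈ Ι (0 : ℝ) s, ‖L (r, z) (picardTerm L y₀ k r z)‖
        ≤ M * (‖y₀‖ * (M ^ k / k.factorial)) * |r - 0| ^ k := by
      intro r hr
      have hrR : |r| ≤ R := by
        rcases mem_uIoc.1 hr with h | h
        · rw [abs_of_pos h.1]; exact h.2.trans ((le_abs_self s).trans hs)
        · rw [abs_of_nonpos h.2]; linarith [neg_abs_le s]
      calc ‖L (r, z) (picardTerm L y₀ k r z)‖ ≤ ‖L (r, z)‖ * ‖picardTerm L y₀ k r z‖ :=
            (L (r, z)).le_opNorm _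
        _ ≤ M * (‖y₀‖ * (M ^ k / k.factorial) * |r| ^ k) := by
            gcongr
            · exact hLM r hrR
            · exact ih hrR
        _ = _ := by rw [sub_zero]; ring
    simp only [picardTerm]
    rw [intervalIntegral.norm_intervalIntegral_eq]
    refine (MeasureTheory.norm_integral_le_of_norm_le
      (g := fun r => M * (‖y₀‖ * (M ^ k / k.factorial)) * |r - 0| ^ k) ?_ ?_).trans ?_
    · refine Continuous.integrableOn_uIoc ?_
      fun_prop
    · exact (MeasureTheory.ae_restrict_iff' measurableSet_uIoc).2 (Filter.Eventually.of_forall hbound)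
    · rw [MeasureTheory.integral_const_mul, integral_pow_abs_sub_uIoc, sub_zero]
      apply le_of_eq
      rw [Nat.factorial_succ]
      have : (k.factorial : ℝ) ≠ 0 := by positivity
      push_cast
      field_simp
      ring

/-- A linear equation `∂_s Y = L(s, z) Y` with continuous coefficients has a solution for all times,
jointly continuous in the time and in the parameter. -/
theorem exists_continuous_linearODE_solution [TopologicalSpace Z] [FirstCountableTopology Z]
    [WeaklyLocallyCompactSpace Z] [CompleteSpace F] {L : ℝ × Z → F →L[ℝ] F} (hL : Continuous L)
    (y₀ : F) :
    ∃ Y : ℝ → Z → F, Continuous (fun p : ℝ × Z => Y p.1 p.2) ∧ (∀ z, Y 0 z = y₀) ∧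
      ∀ s z, HasDerivAt (fun r => Y r z) (L (s, z) (Y s z)) s := by
  have hbd : ∀ (R : ℝ) (K : Set Z), IsCompact K →
      ∃ M, 0 ≤ M ∧ ∀ s, |s| ≤ R → ∀ z ∈ K, ‖L (s, z)‖ ≤ M := by
    intro R K hK
    obtain ⟨M, hM⟩ := (isCompact_Icc (a := -R) (b := R)).prod hK |>.exists_bound_of_continuousOn
      hL.continuousOn
    exact ⟨max M 0, le_max_right _ _, fun s hs z hz =>
      (hM (s, z) ⟨abs_le.1 hs, hz⟩).trans (le_max_left _ _)⟩
  have hterm : ∀ (R : ℝ) (K : Set Z), IsCompact K →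
      ∃ M u, 0 ≤ M ∧ Summable u ∧ (∀ s, |s| ≤ R → ∀ z ∈ K, ‖L (s, z)‖ ≤ M) ∧
        ∀ k s, |s| ≤ R → ∀ z ∈ K, ‖picardTerm L y₀ k s z‖ ≤ (u k : ℝ) := by
    intro R K hK
    obtain ⟨M, hM0, hM⟩ := hbd R K hK
    refine ⟨M, fun k => ‖y₀‖ * ((M * R) ^ k / k.factorial), hM0,
      (Real.summable_pow_div_factorial (M * R)).mul_left _, hM, fun k s hs z hz => ?_⟩
    refine (norm_picardTerm_le y₀ hM0 (fun s hs => hM s hs z hz) k hs).trans ?_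
    calc ‖y₀‖ * (M ^ k / k.factorial) * |s| ^ k ≤ ‖y₀‖ * (M ^ k / k.factorial) * R ^ k := by gcongr
      _ = ‖y₀‖ * ((M * R) ^ k / k.factorial) := by rw [mul_pow]; ring
  -- Weierstrass test on a compact box around the given point.
  have hcont : Continuous fun p : ℝ × Z => ∑' k, picardTerm L y₀ k p.1 p.2 := by
    refine continuous_iff_continuousAt.2 fun p => ?_
    obtain ⟨K, hK, hpK⟩ := exists_compact_mem_nhds p.2
    obtain ⟨M, u, -, hu, -, hb⟩ := hterm (|p.1| + 1) K hK
    refine (continuousOn_tsum (s := Icc (-(|p.1| + 1)) (|p.1| + 1) ×ˢ K)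
      (fun k => (continuous_picardTerm hL y₀ k).continuousOn) hu
      (fun k q hq => hb k q.1 (abs_le.2 hq.1) q.2 hq.2)).continuousAt ?_
    refine prod_mem_nhds (Icc_mem_nhds ?_ ?_) hpK
    · linarith [neg_abs_le p.1]
    · linarith [le_abs_self p.1]
  -- Term k + 1 is the integral of L applied to term k; dominated convergence allows the series to
  -- be summed under the integral.
  have hint : ∀ s z, (∑' k, picardTerm L y₀ k s z)
      = y₀ + ∫ r in (0 : ℝ)..s, L (r, z) (∑' k, picardTerm L y₀ k r z) := by
    intro s z
    obtain ⟨M, u, hM0, hu, hM, hb⟩ := hterm |s| {z} isCompact_singleton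
    have hsum : ∀ r, |r| ≤ |s| → Summable fun k => picardTerm L y₀ k r z := fun r hr =>
      Summable.of_norm_bounded hu fun k => hb k r hr z rfl
    have habs : ∀ r ∈ Ι (0 : ℝ) s, |r| ≤ |s| := by
      intro r hr
      rcases mem_uIoc.1 hr with h | h
      · rw [abs_of_pos h.1]; exact h.2.trans (le_abs_self s)
      · rw [abs_of_nonpos h.2]; linarith [neg_abs_le s]
    have hcz : ∀ k, Continuous fun r : ℝ => L (r, z) (picardTerm L y₀ k r z) := fun k =>
      (hL.comp (by fun_prop : Continuous fun r : ℝ => (r, z))).clm_apply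
        ((continuous_picardTerm hL y₀ k).comp (by fun_prop : Continuous fun r : ℝ => (r, z)))
    rw [(hsum s le_rfl).tsum_eq_zero_add]
    congr 1
    refine HasSum.tsum_eq ?_
    refine intervalIntegral.hasSum_integral_of_dominated_convergence (fun k _ => M * u k)
      (fun k => (hcz k).aestronglyMeasurable) (fun k => Filter.Eventually.of_forall fun r hr => ?_)
      (Filter.Eventually.of_forall fun r _ => hu.mul_left M) (by simp)
      (Filter.Eventually.of_forall fun r hr => ?_)
    · refine ((L (r, z)).le_opNorm _).trans ?_
      gcongr
      · exact hM r (habs r hr) z rfl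
      · exact hb k r (habs r hr) z rfl
    · exact (hsum r (habs r hr)).hasSum.mapL (L (r, z))
  refine ⟨fun s z => ∑' k, picardTerm L y₀ k s z, hcont, fun z => ?_, fun s z => ?_⟩
  · change ∑' k, picardTerm L y₀ k 0 z = y₀
    rw [hint]; simp
  · have hc : Continuous fun r : ℝ => L (r, z) (∑' k, picardTerm L y₀ k r z) :=
      (hL.comp (by fun_prop : Continuous fun r : ℝ => (r, z))).clm_apply
        (hcont.comp (by fun_prop : Continuous fun r : ℝ => (r, z)))
    have := (hc.integral_hasStrictDerivAt 0 s).hasDerivAt.const_add y₀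
    exact this.congr_of_eventuallyEq (Filter.Eventually.of_forall fun r => hint r z)

/-- Solutions of a linear equation with continuous coefficients are determined for positive times
by their initial value. -/
theorem linearODE_unique {L : ℝ → F →L[ℝ] F} (hL : Continuous L) {f g : ℝ → F}
    (hf : ∀ s, 0 ≤ s → HasDerivAt f (L s (f s)) s) (hg : ∀ s, 0 ≤ s → HasDerivAt g (L s (g s)) s)
    (h0 : f 0 = g 0) {s : ℝ} (hs : 0 ≤ s) : f s = g s := by
  obtain ⟨M, hM⟩ := (isCompact_Icc (a := (0 : ℝ)) (b := s)).exists_bound_of_continuousOn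
    hL.continuousOn
  refine sub_eq_zero.1 (eq_zero_of_abs_deriv_le_mul_abs_self_of_eq_zero_right
    (f := fun r => f r - g r) (f' := fun r => L r (f r - g r)) (K := M) (a := 0) (b := s)
    ?_ ?_ (by simp [h0]) ?_ s ⟨hs, le_rfl⟩)
  · exact fun r hr => ((hf r hr.1).sub (hg r hr.1)).continuousAt.continuousWithinAt
  · intro r hr
    rw [map_sub]
    exact ((hf r hr.1).sub (hg r hr.1)).hasDerivWithinAt
  · exact fun r hr => ((L r).le_opNorm _).trans (by gcongr; exact hM r ⟨hr.1, hr.2.le⟩)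

end LinearODE

/-! ### Smooth dependence on the parameter -/

section Smooth

variable {Z : Type} [NormedAddCommGroup Z] [NormedSpace ℝ Z]

/-- The coefficients of the equation solved by a solution `w` and by a `Z`-directional quotient `q`:
`∂_s w = a w`, `∂_s q = b q + (m ·) w`. -/
noncomputable def augmentedCoeff {F : Type} [NormedAddCommGroup F] [NormedSpace ℝ F] :
    ((F →L[ℝ] F) × (F →L[ℝ] F) × (Z →L[ℝ] F →L[ℝ] F)) →L[ℝ]
      (F × (Z →L[ℝ] F)) →L[ℝ] (F × (Z →L[ℝ] F)) := by
  refine LinearMap.mkContinuous₂ (LinearMap.mk₂ ℝ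
    (fun (c : (F →L[ℝ] F) × (F →L[ℝ] F) × (Z →L[ℝ] F →L[ℝ] F)) (y : F × (Z →L[ℝ] F)) =>
      (c.1 y.1, (c.2.1).comp y.2 + c.2.2.flip y.1)) ?_ ?_ ?_ ?_) 2 ?_
  · intro c d y; ext <;> simp; abel
  · intro r c y; ext <;> simp
  · intro c y y'; ext <;> simp; abel
  · intro r c y; ext <;> simp
  -- The second component has two summands, hence the constant 2.
  · rintro ⟨a, b, m⟩ ⟨w, q⟩
    have ha : ‖a‖ ≤ ‖(a, b, m)‖ := norm_fst_le (a, b, m)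
    have hbm : ‖(b, m)‖ ≤ ‖(a, b, m)‖ := norm_snd_le (a, b, m)
    have hb : ‖b‖ ≤ ‖(a, b, m)‖ := (norm_fst_le (b, m)).trans hbm
    have hm : ‖m‖ ≤ ‖(a, b, m)‖ := (norm_snd_le (b, m)).trans hbm
    have hw : ‖w‖ ≤ ‖(w, q)‖ := norm_fst_le (w, q)
    have hq : ‖q‖ ≤ ‖(w, q)‖ := norm_snd_le (w, q)
    have hX := norm_nonneg (a, b, m)
    have hY := norm_nonneg (w, q)
    simp only [LinearMap.mk₂_apply]
    refine norm_prod_le_iff.2 ⟨?_, ?_⟩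
    · calc ‖a w‖ ≤ ‖a‖ * ‖w‖ := a.le_opNorm w
        _ ≤ ‖(a, b, m)‖ * ‖(w, q)‖ := by gcongr
        _ ≤ _ := by nlinarith [mul_nonneg hX hY]
    · calc ‖b.comp q + m.flip w‖ ≤ ‖b.comp q‖ + ‖m.flip w‖ := norm_add_le _ _
        _ ≤ ‖b‖ * ‖q‖ + ‖m‖ * ‖w‖ := by
          gcongr
          · exact b.opNorm_comp_le q
          · exact (m.flip.le_opNorm w).trans_eq (by rw [ContinuousLinearMap.opNorm_flip])
        _ ≤ ‖(a, b, m)‖ * ‖(w, q)‖ + ‖(a, b, m)‖ * ‖(w, q)‖ := by gcongr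
        _ = _ := by ring

variable {F : Type} [NormedAddCommGroup F] [NormedSpace ℝ F]

/-- The partial derivative `D_z L(s, z)`. -/
noncomputable def paramDeriv {V : Type} [NormedAddCommGroup V] [NormedSpace ℝ V] (L : ℝ × Z → V)
    (p : ℝ × Z) : Z →L[ℝ] V :=
  (fderiv ℝ L p).comp (ContinuousLinearMap.inr ℝ ℝ Z)

theorem contDiff_paramDeriv {V : Type} [NormedAddCommGroup V] [NormedSpace ℝ V] {L : ℝ × Z → V}
    (hL : ContDiff ℝ ∞ L) : ContDiff ℝ ∞ (paramDeriv L) :=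
  (hL.fderiv_right (m := ∞) (by simp)).clm_comp contDiff_const

/-- Hadamard's formula, from the fundamental theorem of calculus on the segment from z to y. It
factors the increment of L through y - z with a factor that stays continuous at y = z. -/
theorem paramDeriv_segment {V : Type} [NormedAddCommGroup V] [NormedSpace ℝ V] [CompleteSpace V]
    {L : ℝ × Z → V} (hL : ContDiff ℝ ∞ L) (s : ℝ) (z y : Z) :
    (∫ r in (0 : ℝ)..1, paramDeriv L (s, z + r • (y - z))) (y - z) = L (s, y) - L (s, z) := by
  have hc : Continuous fun r : ℝ => paramDeriv L (s, z + r • (y - z)) :=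
    (contDiff_paramDeriv hL).continuous.comp (by fun_prop)
  rw [ContinuousLinearMap.intervalIntegral_apply (hc.intervalIntegrable 0 1)]
  have hd : ∀ r ∈ uIcc (0 : ℝ) 1, HasDerivAt (fun r : ℝ => L (s, z + r • (y - z)))
      (paramDeriv L (s, z + r • (y - z)) (y - z)) r := by
    intro r _
    have h1 : HasDerivAt (fun r : ℝ => (s, z + r • (y - z))) (0, y - z) r := by
      have := ((hasDerivAt_id r).smul_const (y - z)).const_add z
      simp only [one_smul] at this
      exact (hasDerivAt_const r s).prodMk this
    exact ((hL.differentiable (by simp)) _).hasFDerivAt.comp_hasDerivAt r h1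
  rw [intervalIntegral.integral_eq_sub_of_hasDerivAt hd
    ((hc.clm_apply continuous_const).intervalIntegrable 0 1)]
  simp

variable [FiniteDimensional ℝ Z] [CompleteSpace F]

/-- The solution of a linear equation with smooth coefficients is differentiable with respect to the
parameter, and together with its derivative solves the linearised equation. -/
theorem hasFDerivAt_linearODE_solution {L : ℝ × Z → F →L[ℝ] F} (hL : ContDiff ℝ ∞ L) {y₀ : F}
    {Y : ℝ → Z → F} (h0 : ∀ z, Y 0 z = y₀)
    (hY : ∀ s, 0 ≤ s → ∀ z, HasDerivAt (fun r => Y r z) (L (s, z) (Y s z)) s) :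
    ∃ P : ℝ → Z → Z →L[ℝ] F, (∀ z, P 0 z = 0) ∧
      (∀ s, 0 ≤ s → ∀ z, HasFDerivAt (Y s) (P s z) z) ∧
      ∀ s, 0 ≤ s → ∀ z, HasDerivAt (fun r => (Y r z, P r z))
        (augmentedCoeff (L (s, z), L (s, z), paramDeriv L (s, z)) (Y s z, P s z)) s := by
  have hDL := (contDiff_paramDeriv hL).continuous
  let M : ℝ × Z × Z → Z →L[ℝ] F →L[ℝ] F := fun p =>
    ∫ r in (0 : ℝ)..1, paramDeriv L (p.1, p.2.1 + r • (p.2.2 - p.2.1))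
  have hM : Continuous M := by
    refine intervalIntegral.continuous_parametric_intervalIntegral_of_continuous'
      (f := fun (p : ℝ × Z × Z) r => paramDeriv L (p.1, p.2.1 + r • (p.2.2 - p.2.1))) ?_ 0 1
    exact hDL.comp (by fun_prop)
  -- For a pair of parameters (z, y), the first component of the solution `W` will be Y s y. The
  -- second will be a difference quotient of Y s between z and y that is still defined and
  -- continuous at y = z, where its value is the derivative.
  let N : ℝ × Z × Z → (F × (Z →L[ℝ] F)) →L[ℝ] (F × (Z →L[ℝ] F)) := fun p =>
    augmentedCoeff (L (p.1, p.2.2), L (p.1, p.2.1), M p)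
  have hN : Continuous N := by
    refine augmentedCoeff.continuous.comp ?_
    have h1 : Continuous fun p : ℝ × Z × Z => L (p.1, p.2.2) := hL.continuous.comp (by fun_prop)
    have h2 : Continuous fun p : ℝ × Z × Z => L (p.1, p.2.1) := hL.continuous.comp (by fun_prop)
    exact h1.prodMk (h2.prodMk hM)
  obtain ⟨W, hWc, hW0, hW⟩ := exists_continuous_linearODE_solution hN ((y₀, 0) : F × (Z →L[ℝ] F))
  have hLc : ∀ z, Continuous fun s => L (s, z) := fun z => hL.continuous.comp (by fun_prop)
  have hW1 : ∀ s, 0 ≤ s → ∀ z y, (W s (z, y)).1 = Y s y := by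
    intro s hs z y
    refine linearODE_unique (hLc y) (f := fun s => (W s (z, y)).1) (g := fun s => Y s y)
      (fun r _ => ?_) (fun r hr => hY r hr y) (by simp [hW0, h0]) hs
    exact (ContinuousLinearMap.fst ℝ F (Z →L[ℝ] F)).hasFDerivAt.comp_hasDerivAt r (hW r (z, y))
  have hN2 : ∀ r, 0 ≤ r → ∀ z y, N (r, (z, y)) (W r (z, y)) = (L (r, y) (Y r y),
      (L (r, z)).comp (W r (z, y)).2 + (M (r, z, y)).flip (Y r y)) := by
    intro r hr z y
    rw [← hW1 r hr z y]
    rfl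
  -- The difference of the two sides solves the homogeneous equation with coefficient L(·, z): by
  -- Hadamard's formula the source M (y - z) applied to Y y is (L(·, y) - L(·, z)) (Y y).
  have hW2 : ∀ s, 0 ≤ s → ∀ z y, Y s y - Y s z = (W s (z, y)).2 (y - z) := by
    intro s hs z y
    refine sub_eq_zero.1 (linearODE_unique (hLc z)
      (f := fun s => Y s y - Y s z - (W s (z, y)).2 (y - z)) (g := fun _ => 0) (fun r hr => ?_)
      (fun r _ => by simpa using hasDerivAt_const r (0 : F)) (by simp [hW0, h0]) hs)
    have h2 : HasDerivAt (fun s => (W s (z, y)).2) ((N (r, (z, y)) (W r (z, y))).2) r :=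
      (ContinuousLinearMap.snd ℝ F (Z →L[ℝ] F)).hasFDerivAt.comp_hasDerivAt r (hW r (z, y))
    have h3 := ((hY r hr y).sub (hY r hr z)).sub (h2.clm_apply (hasDerivAt_const r (y - z)))
    refine h3.congr_deriv ?_
    have h6 : M (r, z, y) (y - z) = L (r, y) - L (r, z) := paramDeriv_segment hL r z y
    simp only [hN2 r hr, add_apply, ContinuousLinearMap.comp_apply, map_zero,
      ContinuousLinearMap.flip_apply, h6, sub_apply]
    simp only [map_sub]
    abel
  refine ⟨fun s z => (W s (z, z)).2, fun z => by simp [hW0], fun s hs z => ?_, fun s hs z => ?_⟩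
  · refine HasFDerivAt.of_isLittleO (Asymptotics.isLittleO_iff.2 fun c hc => ?_)
    have hq : Continuous fun y => (W s (z, y)).2 - (W s (z, z)).2 := by
      have : Continuous fun y => W s (z, y) :=
        hWc.comp (by fun_prop : Continuous fun y : Z => (s, (z, y)))
      exact this.snd.sub continuous_const
    have hq0 := hq.norm.tendsto z
    simp only [sub_self, norm_zero] at hq0
    filter_upwards [hq0.eventually_lt_const hc] with y hy
    rw [hW2 s hs, ← sub_apply]
    exact (ContinuousLinearMap.le_opNorm _ _).trans (by gcongr)
  · have hYr : (fun r => (Y r z, (W r (z, z)).2)) =ᶠ[nhdsWithin s (Ici 0)]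
        fun r => W r (z, z) := by
      filter_upwards [self_mem_nhdsWithin] with r hr
      rw [← hW1 r hr z z]
    have h1 := hN2 s hs z z
    have hMz : M (s, z, z) = paramDeriv L (s, z) := by simp [M]
    have h2 : HasDerivAt (fun r => (W r (z, z)).2)
        ((L (s, z)).comp (W s (z, z)).2 + (paramDeriv L (s, z)).flip (Y s z)) s := by
      have := (ContinuousLinearMap.snd ℝ F (Z →L[ℝ] F)).hasFDerivAt.comp_hasDerivAt s
        (hW s (z, z))
      rw [h1, hMz] at this
      exact this
    exact (hY s hs z).prodMk h2

/-- The solution of a linear equation with smooth coefficients depends smoothly on the parameter. -/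
theorem contDiff_linearODE_solution (m : ℕ) {F : Type} [NormedAddCommGroup F] [NormedSpace ℝ F]
    [CompleteSpace F] {L : ℝ × Z → F →L[ℝ] F} (hL : ContDiff ℝ ∞ L) {y₀ : F}
    {Y : ℝ → Z → F} (h0 : ∀ z, Y 0 z = y₀)
    (hY : ∀ s, 0 ≤ s → ∀ z, HasDerivAt (fun r => Y r z) (L (s, z) (Y s z)) s) {s : ℝ}
    (hs : 0 ≤ s) : ContDiff ℝ m (Y s) := by
  -- The pair (Y, D_z Y) solves an equation of the same kind with constant initial value, but in a
  -- larger space; the induction therefore has to run over all `F`.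
  induction m generalizing F s with
  | zero =>
    obtain ⟨P, -, hP, -⟩ := hasFDerivAt_linearODE_solution hL h0 hY
    exact contDiff_zero.2 (continuous_iff_continuousAt.2 fun z => (hP s hs z).continuousAt)
  | succ m ih =>
    obtain ⟨P, hP0, hP, hYP⟩ := hasFDerivAt_linearODE_solution hL h0 hY
    have hL' : ContDiff ℝ ∞ fun p : ℝ × Z => augmentedCoeff (L p, L p, paramDeriv L p) :=
      ContDiff.comp (g := fun c : (F →L[ℝ] F) × (F →L[ℝ] F) × (Z →L[ℝ] F →L[ℝ] F) =>
        augmentedCoeff c) (by fun_prop) (hL.prodMk (hL.prodMk (contDiff_paramDeriv hL)))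
    have hind := ih hL' (y₀ := ((y₀, 0) : F × (Z →L[ℝ] F))) (Y := fun s z => (Y s z, P s z))
      (fun z => by simp [h0, hP0]) hYP hs
    have hfd : fderiv ℝ (Y s) = P s := funext fun z => (hP s hs z).fderiv
    push_cast
    refine contDiff_succ_iff_fderiv.2 ⟨fun z => (hP s hs z).differentiableAt, by simp, ?_⟩
    rw [hfd]
    exact hind.snd

/-- A linear equation `∂_t w = L(t, x) w` with smooth coefficients and constant initial value at the
time `t₀` has a solution that is smooth in `(t, x)`. -/
theorem exists_contDiff_linearODE_solution {X : Type} [NormedAddCommGroup X] [NormedSpace ℝ X]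
    [FiniteDimensional ℝ X] {F : Type} [NormedAddCommGroup F] [NormedSpace ℝ F]
    [CompleteSpace F] {L : ℝ × X → F →L[ℝ] F} (hL : ContDiff ℝ ∞ L) (t₀ : ℝ) (y₀ : F) :
    ∃ w : ℝ × X → F, ContDiff ℝ ∞ w ∧ (∀ x, w (t₀, x) = y₀) ∧
      ∀ t x, HasDerivAt (fun r => w (r, x)) (L (t, x) (w (t, x))) t := by
  have hL₁ : Continuous fun p : ℝ × X => L (t₀ + p.1, p.2) := hL.continuous.comp (by fun_prop)
  obtain ⟨u, -, hu0, hu⟩ := exists_continuous_linearODE_solution hL₁ y₀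
  -- Rescaling time by t - t₀ turns t into a parameter, the solution being read off at s = 1.
  -- Smoothness in the parameter then includes smoothness in t, and s ≥ 0 suffices for t on either
  -- side of t₀.
  let L₂ : ℝ × (ℝ × X) → F →L[ℝ] F := fun p => (p.2.1 - t₀) • L (t₀ + p.1 * (p.2.1 - t₀), p.2.2)
  have hL₂ : ContDiff ℝ ∞ L₂ := by
    have h1 : ContDiff ℝ ∞ fun p : ℝ × (ℝ × X) => p.2.1 - t₀ := by fun_prop
    have h2 : ContDiff ℝ ∞ fun p : ℝ × (ℝ × X) => (t₀ + p.1 * (p.2.1 - t₀), p.2.2) := by fun_prop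
    exact h1.smul (hL.comp h2)
  have hY : ∀ s, 0 ≤ s → ∀ z : ℝ × X, HasDerivAt (fun r => u (r * (z.1 - t₀)) z.2)
      (L₂ (s, z) (u (s * (z.1 - t₀)) z.2)) s := by
    intro s _ z
    have h1 := HasDerivAt.scomp s (hu (s * (z.1 - t₀)) z.2)
      ((hasDerivAt_id s).mul_const (z.1 - t₀))
    rw [one_mul] at h1
    exact h1
  have hsm : ∀ m : ℕ, ContDiff ℝ m fun z : ℝ × X => u (1 * (z.1 - t₀)) z.2 := fun m =>
    contDiff_linearODE_solution m hL₂ (Y := fun s z => u (s * (z.1 - t₀)) z.2) (y₀ := y₀)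
      (fun z => by simp [hu0]) hY zero_le_one
  simp only [one_mul] at hsm
  refine ⟨fun z => u (z.1 - t₀) z.2, contDiff_infty.2 hsm, fun x => by simp [hu0], fun t x => ?_⟩
  have := (hu (t - t₀) x).comp_sub_const t t₀
  simpa using this

end Smooth

/-! ### Curves in a compact matrix group -/

section Group

variable {n : ℕ}

/-- The set of matrices underlying a group of invertible matrices. -/
def matrixSet (G : Subgroup (Matrix.GeneralLinearGroup (Fin n) ℂ)) : Set (Mat n) :=
  (fun g : Matrix.GeneralLinearGroup (Fin n) ℂ => (g : Mat n)) '' (G : Set _)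

theorem isCompact_matrixSet {G : Subgroup (Matrix.GeneralLinearGroup (Fin n) ℂ)}
    (hG : IsCompact (G : Set (Matrix.GeneralLinearGroup (Fin n) ℂ))) :
    IsCompact (matrixSet G) :=
  hG.image Units.continuous_val

/-- A solution of `W' = W b - a W`, with `a` and `b` taking values in the Lie algebra of a compact
group `G`, stays in `G`. -/
theorem mem_matrixSet_of_hasDerivAt {G : Subgroup (Matrix.GeneralLinearGroup (Fin n) ℂ)}
    (hG : IsCompact (G : Set (Matrix.GeneralLinearGroup (Fin n) ℂ))) {a b W : ℝ → Mat n}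
    {s₀ s₁ : ℝ} (hs : s₀ ≤ s₁) (ha : ContinuousOn a (Icc s₀ s₁)) (hb : ContinuousOn b (Icc s₀ s₁))
    (hag : ∀ s ∈ Icc s₀ s₁, a s ∈ lieAlg G) (hbg : ∀ s ∈ Icc s₀ s₁, b s ∈ lieAlg G)
    (hW : ∀ s ∈ Icc s₀ s₁, HasDerivAt W (W s * b s - a s * W s) s) (h0 : W s₀ ∈ matrixSet G) :
    W s₁ ∈ matrixSet G := by
  have hK := isCompact_matrixSet hG
  have hne : (matrixSet G).Nonempty := ⟨_, h0⟩
  obtain ⟨Ma, hMa⟩ := (isCompact_Icc (a := s₀) (b := s₁)).exists_bound_of_continuousOn ha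
  obtain ⟨Mb, hMb⟩ := (isCompact_Icc (a := s₀) (b := s₁)).exists_bound_of_continuousOn hb
  -- Grönwall's inequality for the distance from W to the group, which starts at zero.
  have key := le_gronwallBound_of_liminf_deriv_right_le
    (f := fun s => Metric.infDist (W s) (matrixSet G))
    (f' := fun s => (Ma + Mb) * Metric.infDist (W s) (matrixSet G)) (δ := 0) (K := Ma + Mb)
    (ε := 0) (a := s₀) (b := s₁) ?_ ?_ ?_ ?_ s₁ ⟨hs, le_rfl⟩
  · rw [gronwallBound_ε0_δ0] at key
    exact (hK.isClosed.mem_iff_infDist_zero hne).2 (le_antisymm key Metric.infDist_nonneg)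
  · intro s hs
    exact ((Metric.continuous_infDist_pt _).continuousAt.comp
      (hW s hs).continuousAt).continuousWithinAt
  · intro x hx r hr
    have hx' : x ∈ Icc s₀ s₁ := ⟨hx.1, hx.2.le⟩
    obtain ⟨g, hg, hgx⟩ := hK.exists_infDist_eq_dist hne (W x)
    -- A comparison curve inside G through the point g nearest to W x, with velocity g b - a g at x.
    -- The velocity of W - E is then linear in W x - g, so the distance to G grows at most at the
    -- rate (Ma + Mb) times itself.
    let E : ℝ → Mat n := fun z =>
      NormedSpace.exp ((z - x) • (-a x)) * g * NormedSpace.exp ((z - x) • b x)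
    have hE : ∀ z, E z ∈ matrixSet G := by
      intro z
      obtain ⟨g₀, hg₀, rfl⟩ := hg
      obtain ⟨g₁, hg₁, h₁⟩ := hag x hx' (-(z - x))
      obtain ⟨g₂, hg₂, h₂⟩ := hbg x hx' (z - x)
      refine ⟨g₁ * g₀ * g₂, G.mul_mem (G.mul_mem hg₁ hg₀) hg₂, ?_⟩
      simp only [E, Units.val_mul, h₁, h₂, smul_neg, neg_smul]
    have hexp : ∀ X : Mat n, HasDerivAt (fun z : ℝ => NormedSpace.exp ((z - x) • X)) X x := by
      intro X
      have := (hasDerivAt_exp_smul_const (𝕂 := ℝ) X (x - x)).comp_sub_const x x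
      simpa using this
    have hE' : HasDerivAt E (-a x * g + g * b x) x := by
      have := ((hexp (-a x)).mul_const g).mul (hexp (b x))
      exact this.congr_deriv (by simp)
    have hEx : E x = g := by simp [E]
    have hD : HasDerivAt (fun z => W z - E z) ((W x - g) * b x - a x * (W x - g)) x := by
      refine ((hW x hx').sub hE').congr_deriv ?_
      noncomm_ring
    have hnorm : ‖(W x - g) * b x - a x * (W x - g)‖ < r := by
      refine lt_of_le_of_lt ?_ hr
      calc ‖(W x - g) * b x - a x * (W x - g)‖
          ≤ ‖(W x - g) * b x‖ + ‖a x * (W x - g)‖ := norm_sub_le _ _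
        _ ≤ ‖W x - g‖ * ‖b x‖ + ‖a x‖ * ‖W x - g‖ := by gcongr <;> exact norm_mul_le _ _
        _ ≤ ‖W x - g‖ * Mb + Ma * ‖W x - g‖ := by
            gcongr
            · exact hMb x hx'
            · exact hMa x hx'
        _ = (Ma + Mb) * Metric.infDist (W x) (matrixSet G) := by
            rw [hgx, dist_eq_norm]; ring
    refine ((hD.hasDerivWithinAt.liminf_right_slope_norm_le hnorm).and_eventually
      self_mem_nhdsWithin).mono fun z hz => lt_of_le_of_lt ?_ hz.1
    have hzx : 0 < z - x := sub_pos.2 hz.2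
    refine mul_le_mul_of_nonneg_left ?_ (inv_nonneg.2 hzx.le)
    rw [hEx, hgx, ← dist_eq_norm (W x) g, ← dist_eq_norm (W z)]
    gcongr
    exact Metric.infDist_le_dist_of_mem (hE z)
  · rw [Metric.infDist_zero_of_mem h0]
  · intro x _
    simp

end Group

/-! ### The open diamond -/

section Diamond

/-- The open causal diamond. -/
def openDiamond : Set Spacetime := {z | ‖z.2‖ < z.1 + 1 ∧ ‖z.2‖ < 1 - z.1}

theorem isOpen_openDiamond : IsOpen openDiamond := by
  have h1 : Continuous fun z : Spacetime => ‖z.2‖ := by fun_prop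
  have h2 : Continuous fun z : Spacetime => z.1 + 1 := by fun_prop
  have h3 : Continuous fun z : Spacetime => 1 - z.1 := by fun_prop
  exact (isOpen_lt h1 h2).inter (isOpen_lt h1 h3)

theorem openDiamond_subset_diamond : openDiamond ⊆ diamond := fun _ hz => ⟨hz.1.le, hz.2.le⟩

theorem isClosed_diamond : IsClosed diamond := by
  have h1 : Continuous fun z : Spacetime => ‖z.2‖ := by fun_prop
  have h2 : Continuous fun z : Spacetime => z.1 + 1 := by fun_prop
  have h3 : Continuous fun z : Spacetime => 1 - z.1 := by fun_prop
  exact (isClosed_le h1 h2).inter (isClosed_le h1 h3)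

theorem isCompact_diamond : IsCompact diamond := by
  refine Metric.isCompact_of_isClosed_isBounded isClosed_diamond ?_
  refine (Metric.isBounded_closedBall (x := (0 : Spacetime)) (r := 1)).subset fun z hz => ?_
  have h0 := norm_nonneg z.2
  rw [mem_closedBall_zero_iff, norm_prod_le_iff, Real.norm_eq_abs, abs_le]
  exact ⟨⟨by linarith [hz.1], by linarith [hz.2]⟩, by linarith [hz.1, hz.2]⟩

theorem convex_diamond : Convex ℝ diamond := by
  intro z hz w hw a b ha hb hab
  have h : ‖a • z.2 + b • w.2‖ ≤ a * ‖z.2‖ + b * ‖w.2‖ :=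
    (norm_add_le _ _).trans_eq (by rw [norm_smul_of_nonneg ha, norm_smul_of_nonneg hb])
  refine ⟨?_, ?_⟩
  · have h1 := mul_le_mul_of_nonneg_left hz.1 ha
    have h2 := mul_le_mul_of_nonneg_left hw.1 hb
    simp only [Prod.snd_add, Prod.smul_snd, Prod.fst_add, Prod.smul_fst, smul_eq_mul]
    linarith
  · have h1 := mul_le_mul_of_nonneg_left hz.2 ha
    have h2 := mul_le_mul_of_nonneg_left hw.2 hb
    simp only [Prod.snd_add, Prod.smul_snd, Prod.fst_add, Prod.smul_fst, smul_eq_mul]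
    linarith

theorem zero_mem_openDiamond : (0 : Spacetime) ∈ openDiamond := by
  simp [openDiamond]

theorem uniqueDiffOn_diamond : UniqueDiffOn ℝ diamond :=
  uniqueDiffOn_convex convex_diamond
    ⟨0, interior_maximal openDiamond_subset_diamond isOpen_openDiamond zero_mem_openDiamond⟩

/-- Contracting towards the origin by a factor s < 1 moves every point of the diamond into its
interior. This carries identities from the open diamond to its boundary. -/
theorem diamond_subset_closure_openDiamond : diamond ⊆ closure openDiamond := by
  intro z hz
  have hc : ContinuousWithinAt (fun s : ℝ => s • z) (Iio 1) 1 := by fun_prop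
  have hcl : (1 : ℝ) ∈ closure (Ioo (0 : ℝ) 1) := by simp
  have := (hc.mono Ioo_subset_Iio_self).mem_closure_image hcl
  rw [one_smul] at this
  refine closure_mono ?_ this
  rintro _ ⟨s, hs, rfl⟩
  have h1 := mul_le_mul_of_nonneg_left hz.1 hs.1.le
  have h2 := mul_le_mul_of_nonneg_left hz.2 hs.1.le
  have hn : ‖s • z.2‖ = s * ‖z.2‖ := norm_smul_of_nonneg hs.1.le _
  refine ⟨?_, ?_⟩
  · simp only [Prod.smul_snd, Prod.smul_fst, smul_eq_mul, hn]
    linarith [hs.2]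
  · simp only [Prod.smul_snd, Prod.smul_fst, smul_eq_mul, hn]
    linarith [hs.2]

end Diamond

/-! ### The energy estimate for symmetric hyperbolic systems -/

section Energy

/-- Around each point the extension by zero coincides either with g or with 0, because K is closed
and contained in the open set O. The next two lemmas rest on the same remark; together they let
boundary terms disappear without integrating over the boundary of the diamond. -/
theorem fderiv_indicator_of_eq_zero {g : Spacetime → ℝ} {O K : Set Spacetime}
    (hO : IsOpen O) (hK : IsClosed K) (hKO : K ⊆ O) (h0 : ∀ z ∈ O, z ∉ K → g z = 0) :
    fderiv ℝ (O.indicator g) = O.indicator (fderiv ℝ g) := by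
  ext1 z
  by_cases hz : z ∈ O
  · rw [indicator_of_mem hz]
    refine Filter.EventuallyEq.fderiv_eq ?_
    filter_upwards [hO.mem_nhds hz] with y hy using indicator_of_mem hy g
  · rw [indicator_of_notMem hz]
    have hev : O.indicator g =ᶠ[nhds z] fun _ => 0 := by
      filter_upwards [hK.isOpen_compl.mem_nhds fun h => hz (hKO h)] with y hy
      by_cases hyO : y ∈ O
      · rw [indicator_of_mem hyO, h0 y hyO hy]
      · rw [indicator_of_notMem hyO]
    rw [hev.fderiv_eq, fderiv_fun_const]
    rfl

theorem contDiff_indicator_of_eq_zero {g : Spacetime → ℝ} (hg : ContDiff ℝ 1 g)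
    {O K : Set Spacetime} (hO : IsOpen O) (hK : IsClosed K) (hKO : K ⊆ O)
    (h0 : ∀ z ∈ O, z ∉ K → g z = 0) : ContDiff ℝ 1 (O.indicator g) := by
  refine contDiff_iff_contDiffAt.2 fun z => ?_
  by_cases hz : z ∈ O
  · refine hg.contDiffAt.congr_of_eventuallyEq ?_
    filter_upwards [hO.mem_nhds hz] with y hy using indicator_of_mem hy g
  · refine (contDiffAt_const (c := (0 : ℝ))).congr_of_eventuallyEq ?_
    filter_upwards [hK.isOpen_compl.mem_nhds fun h => hz (hKO h)] with y hy
    by_cases hyO : y ∈ O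
    · rw [indicator_of_mem hyO, h0 y hyO hy]
    · rw [indicator_of_notMem hyO]

theorem hasCompactSupport_indicator_of_eq_zero {g : Spacetime → ℝ}
    {O K : Set Spacetime} (hK : IsCompact K)
    (h0 : ∀ z ∈ O, z ∉ K → g z = 0) : HasCompactSupport (O.indicator g) := by
  refine HasCompactSupport.intro hK fun z hz => ?_
  by_cases hzO : z ∈ O
  · rw [indicator_of_mem hzO, h0 z hzO hz]
  · rw [indicator_of_notMem hzO]

/-- Integration by parts against the constant function 1. -/
theorem integral_fderiv_eq_zero {g : Spacetime → ℝ} (hg : ContDiff ℝ 1 g)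
    (hc : HasCompactSupport g) (v : Spacetime) : ∫ z, fderiv ℝ g z v = 0 := by
  have hcont : Continuous fun z => fderiv ℝ g z v :=
    (hg.continuous_fderiv one_ne_zero).clm_apply continuous_const
  have hsupp : HasCompactSupport fun z => fderiv ℝ g z v := hc.fderiv_apply ℝ v
  have hHaar : (MeasureTheory.volume : MeasureTheory.Measure Spacetime).IsAddHaarMeasure := by
    rw [MeasureTheory.Measure.volume_eq_prod]
    infer_instance
  have := integral_mul_fderiv_eq_neg_fderiv_mul_of_integrable (𝕜 := ℝ)
    (μ := (MeasureTheory.volume : MeasureTheory.Measure Spacetime))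
    (f := fun _ : Spacetime => (1 : ℝ)) (g := g) (v := v) (by simp)
    (by simpa using hcont.integrable_of_hasCompactSupport hsupp)
    (by simpa using hg.continuous.integrable_of_hasCompactSupport hc)
    (fun x _ => differentiableAt_const _) (fun x _ => hg.differentiable one_ne_zero x)
  simpa using this

/-- The partial derivative `∂_μ`. -/
noncomputable def pd {V : Type*} [NormedAddCommGroup V] [NormedSpace ℝ V] (μ : Fin 4)
    (f : Spacetime → V) (z : Spacetime) : V :=
  fderiv ℝ f z (coordVec μ)

/-- The function `(1 - t)² - |x|² - η`. -/
noncomputable def coneFun (η : ℝ) (z : Spacetime) : ℝ := (1 - z.1) ^ 2 - ‖z.2‖ ^ 2 - η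

/-- The weight `exp(-κ t) h((1 - t)² - |x|² - η)` of the energy estimate, where `h` is a smooth
increasing function vanishing exactly on the negative half-line. -/
noncomputable def energyWeight (κ η : ℝ) (z : Spacetime) : ℝ :=
  Real.exp (-κ * z.1) * expNegInvGlue (coneFun η z)

theorem contDiff_coneFun (η : ℝ) : ContDiff ℝ 1 (coneFun η) := by
  unfold coneFun
  have : ContDiff ℝ 1 fun z : Spacetime => ‖z.2‖ ^ 2 := contDiff_snd.norm_sq ℝ
  fun_prop

theorem contDiff_energyWeight (κ η : ℝ) : ContDiff ℝ 1 (energyWeight κ η) := by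
  unfold energyWeight
  refine ContDiff.mul (by fun_prop) ?_
  exact (expNegInvGlue.contDiff (n := 1)).comp (contDiff_coneFun η)

theorem hasFDerivAt_coneFun (η : ℝ) (z : Spacetime) :
    HasFDerivAt (coneFun η) ((-(2 * (1 - z.1))) • ContinuousLinearMap.fst ℝ ℝ _ -
      (2 : ℝ) • (innerSL ℝ z.2).comp (ContinuousLinearMap.snd ℝ ℝ _)) z := by
  have h1 : HasFDerivAt (fun z : Spacetime => (1 - z.1) ^ 2)
      ((-(2 * (1 - z.1))) • ContinuousLinearMap.fst ℝ ℝ _) z := by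
    refine ((hasFDerivAt_fst.const_sub 1).pow 2).congr_fderiv ?_
    ext <;> simp
  have h2 := (hasFDerivAt_snd (𝕜 := ℝ) (E := ℝ) (F := EuclideanSpace ℝ (Fin 3)) (p := z)).norm_sq
  refine ((h1.sub h2).sub_const η).congr_fderiv ?_
  ext <;> simp

theorem hasFDerivAt_energyWeight (κ η : ℝ) (z : Spacetime) :
    HasFDerivAt (energyWeight κ η) ((-κ * energyWeight κ η z) • ContinuousLinearMap.fst ℝ ℝ _ +
      (Real.exp (-κ * z.1) * deriv expNegInvGlue (coneFun η z)) •
        ((-(2 * (1 - z.1))) • ContinuousLinearMap.fst ℝ ℝ _ -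
      (2 : ℝ) • (innerSL ℝ z.2).comp (ContinuousLinearMap.snd ℝ ℝ _))) z := by
  have h1 : HasFDerivAt (fun z : Spacetime => Real.exp (-κ * z.1))
      ((Real.exp (-κ * z.1) * -κ) • ContinuousLinearMap.fst ℝ ℝ _) z := by
    refine ((hasFDerivAt_fst.const_mul (-κ)).exp).congr_fderiv ?_
    ext <;> simp
  have h2 : HasDerivAt expNegInvGlue (deriv expNegInvGlue (coneFun η z)) (coneFun η z) :=
    ((expNegInvGlue.contDiff (n := 1)).differentiable (by simp) _).hasDerivAt
  refine (h1.mul (h2.comp_hasFDerivAt z (hasFDerivAt_coneFun η z))).congr_fderiv ?_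
  ext <;> simp [energyWeight] <;> ring

/-- The term with κ is there to absorb the residual; the other one measures the energy flux through
the hyperboloids on which `coneFun` is constant. -/
theorem pd_energyWeight_zero (κ η : ℝ) (z : Spacetime) : pd 0 (energyWeight κ η) z =
    -κ * energyWeight κ η z
      - 2 * (1 - z.1) * (Real.exp (-κ * z.1) * deriv expNegInvGlue (coneFun η z)) := by
  rw [pd, (hasFDerivAt_energyWeight κ η z).fderiv]
  simp [coordVec]
  ring

theorem pd_energyWeight_succ (κ η : ℝ) (z : Spacetime) (i : Fin 3) :
    pd i.succ (energyWeight κ η) z =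
      - (2 * z.2 i) * (Real.exp (-κ * z.1) * deriv expNegInvGlue (coneFun η z)) := by
  rw [pd, (hasFDerivAt_energyWeight κ η z).fderiv]
  simp [coordVec, EuclideanSpace.inner_single_right]
  ring

variable {ι H : Type*} [Fintype ι] [NormedAddCommGroup H] [InnerProductSpace ℝ H]

/-- The energy density and the energy flux of a symmetric hyperbolic system. -/
noncomputable def energyCurrent (M : Fin 3 → ι → ι → ℝ) (u : ι → Spacetime → H) :
    Fin 4 → Spacetime → ℝ :=
  Fin.cons (fun z => ∑ k, inner ℝ (u k z) (u k z))
    (fun i z => -∑ k, ∑ l, M i k l * inner ℝ (u k z) (u l z))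

theorem contDiff_energyCurrent (M : Fin 3 → ι → ι → ℝ) {u : ι → Spacetime → H}
    (hu : ∀ k, ContDiff ℝ 1 (u k)) (μ : Fin 4) : ContDiff ℝ 1 (energyCurrent M u μ) := by
  refine Fin.cases ?_ (fun i => ?_) μ
  · exact ContDiff.sum fun k _ => (hu k).inner ℝ (hu k)
  · refine ContDiff.neg (ContDiff.sum fun k _ => ContDiff.sum fun l _ => ?_)
    exact contDiff_const.mul ((hu k).inner ℝ (hu l))

/-- The divergence of the energy current of a symmetric hyperbolic system is a pairing with the
residual. -/
theorem sum_pd_energyCurrent {M : Fin 3 → ι → ι → ℝ} (hM : ∀ i k l, M i k l = M i l k)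
    {u : ι → Spacetime → H} (hu : ∀ k, ContDiff ℝ 1 (u k)) (z : Spacetime) :
    ∑ μ, pd μ (energyCurrent M u μ) z = ∑ k, 2 * inner ℝ (u k z)
      (pd 0 (u k) z - ∑ i : Fin 3, ∑ l, M i k l • pd i.succ (u l) z) := by
  have hd : ∀ k, DifferentiableAt ℝ (u k) z := fun k => (hu k).differentiable one_ne_zero z
  have h0 : pd 0 (energyCurrent M u 0) z = ∑ k, 2 * inner ℝ (u k z) (pd 0 (u k) z) := by
    simp only [energyCurrent, Fin.cons_zero, pd]
    rw [fderiv_fun_sum fun k _ => (hd k).inner ℝ (hd k)]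
    simp only [_root_.sum_apply, fderiv_inner_apply ℝ (hd _) (hd _)]
    refine Finset.sum_congr rfl fun k _ => ?_
    rw [real_inner_comm (u k z)]
    ring
  have hi : ∀ i : Fin 3, pd i.succ (energyCurrent M u i.succ) z
      = -∑ k, ∑ l, 2 * (M i k l * inner ℝ (u k z) (pd i.succ (u l) z)) := by
    intro i
    have hkl : ∀ k l, DifferentiableAt ℝ (fun z => M i k l * inner ℝ (u k z) (u l z)) z :=
      fun k l => ((hd k).inner ℝ (hd l)).const_mul _
    simp only [energyCurrent, Fin.cons_succ, pd]
    rw [fderiv_fun_neg, fderiv_fun_sum fun k _ => DifferentiableAt.fun_sum fun l _ => hkl k l]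
    simp only [neg_apply, _root_.sum_apply, fderiv_fun_sum fun l _ => hkl _ l,
      fderiv_const_mul ((hd _).inner ℝ (hd _)), smul_apply, smul_eq_mul,
      fderiv_inner_apply ℝ (hd _) (hd _), mul_add, Finset.sum_add_distrib]
    -- Symmetry of the matrices makes the two halves of the product rule equal, so no derivative is
    -- left outside the residual.
    have hswap : ∑ k, ∑ l, M i k l * inner ℝ (fderiv ℝ (u k) z (coordVec i.succ)) (u l z)
        = ∑ k, ∑ l, M i k l * inner ℝ (u k z) (fderiv ℝ (u l) z (coordVec i.succ)) := by
      rw [Finset.sum_comm]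
      refine Finset.sum_congr rfl fun k _ => Finset.sum_congr rfl fun l _ => ?_
      rw [hM i l k, real_inner_comm]
    rw [hswap]
    simp only [← Finset.mul_sum]
    ring
  rw [Fin.sum_univ_succ, h0, Finset.sum_congr rfl fun i _ => hi i]
  simp only [inner_sub_right, inner_sum, inner_smul_right, mul_sub, Finset.sum_sub_distrib,
    Finset.sum_neg_distrib, Finset.mul_sum]
  rw [Finset.sum_comm, sub_eq_add_neg]

/-- **Uniqueness for symmetric hyperbolic systems of speed at most one.** If `u` solves
`∂_t u = ∑ M_i ∂_i u + O(u)` in the open diamond, with constant symmetric matrices `M_i` such that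
`∑ ξ_i M_i ≤ 1` for `|ξ| ≤ 1`, and vanishes near the lower boundary, then `u = 0`. -/
theorem eq_zero_of_symmetricHyperbolic {M : Fin 3 → ι → ι → ℝ} (hM : ∀ i k l, M i k l = M i l k)
    (hspeed : ∀ (ξ : Fin 3 → ℝ) (v : ι → H), ∑ i, ξ i ^ 2 ≤ 1 →
      ∑ i, ξ i * ∑ k, ∑ l, M i k l * inner ℝ (v k) (v l) ≤ ∑ k, inner ℝ (v k) (v k))
    {u : ι → Spacetime → H} (hu : ∀ k, ContDiff ℝ 1 (u k)) {C δ : ℝ} (hC0 : 0 ≤ C) (hδ : 0 < δ)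
    (hC : ∀ z ∈ openDiamond, ∀ k, ‖pd 0 (u k) z - ∑ i : Fin 3, ∑ l, M i k l • pd i.succ (u l) z‖
      ≤ C * ∑ l, ‖u l z‖)
    (hlow : ∀ z ∈ openDiamond, z.1 + 1 - ‖z.2‖ < δ → ∀ k, u k z = 0) :
    ∀ z ∈ openDiamond, ∀ k, u k z = 0 := by
  intro z₀ hz₀
  have hz₀n := norm_nonneg z₀.2
  -- Half the value at z₀: the weight is positive at z₀, while its support stays away from the upper
  -- cone.
  set η : ℝ := ((1 - z₀.1) ^ 2 - ‖z₀.2‖ ^ 2) / 2 with hη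
  have hηpos : 0 < η := by
    have : ‖z₀.2‖ ^ 2 < (1 - z₀.1) ^ 2 := by gcongr; exact hz₀.2
    linarith
  -- The 2 comes from differentiating a square, the cardinality from Cauchy–Schwarz on the sum of
  -- norms; the extra 1 leaves a strictly negative multiple of the energy.
  set κ : ℝ := 2 * C * Fintype.card ι + 1 with hκ
  let g : Fin 4 → Spacetime → ℝ := fun μ z => energyWeight κ η z * energyCurrent M u μ z
  have hg : ∀ μ, ContDiff ℝ 1 (g μ) := fun μ =>
    (contDiff_energyWeight κ η).mul (contDiff_energyCurrent M hu μ)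
  -- Inside the open diamond the weighted current lives on K, which is compact and touches neither
  -- boundary: u vanishes near the lower one, the weight near the upper one.
  let K : Set Spacetime := diamond ∩ ({z | δ ≤ z.1 + 1 - ‖z.2‖} ∩ {z | 0 ≤ coneFun η z})
  have hK : IsCompact K := by
    have h1 : Continuous fun z : Spacetime => z.1 + 1 - ‖z.2‖ := by fun_prop
    exact isCompact_diamond.inter_right ((isClosed_le continuous_const h1).inter
      (isClosed_le continuous_const (contDiff_coneFun η).continuous))
  have hKO : K ⊆ openDiamond := by
    rintro z ⟨hzD, hz1, hz2⟩
    have hn := norm_nonneg z.2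
    simp only [mem_ofPred_eq, coneFun] at hz1 hz2
    refine ⟨by linarith, ?_⟩
    have : 0 ≤ 1 - z.1 := hn.trans hzD.2
    exact lt_of_pow_lt_pow_left₀ 2 this (by linarith)
  have hg0 : ∀ μ, ∀ z ∈ openDiamond, z ∉ K → g μ z = 0 := by
    intro μ z hz hzK
    by_cases h1 : δ ≤ z.1 + 1 - ‖z.2‖
    · have h2 : ¬ 0 ≤ coneFun η z := fun h2 => hzK ⟨openDiamond_subset_diamond hz, h1, h2⟩
      simp only [g, energyWeight, expNegInvGlue.zero_of_nonpos (not_le.1 h2).le, mul_zero, zero_mul]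
    · have h2 := hlow z hz (not_le.1 h1)
      have : energyCurrent M u μ z = 0 := by
        refine Fin.cases ?_ (fun i => ?_) μ <;> simp [energyCurrent, h2]
      simp only [g, this, mul_zero]
  have hind : ∀ μ, ∫ z, openDiamond.indicator (pd μ (g μ)) z = 0 := by
    intro μ
    have h1 := integral_fderiv_eq_zero
      (contDiff_indicator_of_eq_zero (hg μ) isOpen_openDiamond hK.isClosed hKO (hg0 μ))
      (hasCompactSupport_indicator_of_eq_zero hK (hg0 μ)) (coordVec μ)
    rw [fderiv_indicator_of_eq_zero isOpen_openDiamond hK.isClosed hKO (hg0 μ)] at h1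
    rw [← h1]
    congr 1
    ext z
    by_cases hz : z ∈ openDiamond <;> simp [hz, pd]
  have hint : ∀ μ, MeasureTheory.Integrable (openDiamond.indicator (pd μ (g μ))) := by
    intro μ
    have hcd := contDiff_indicator_of_eq_zero (hg μ) isOpen_openDiamond hK.isClosed hKO (hg0 μ)
    have hcs := hasCompactSupport_indicator_of_eq_zero hK (hg0 μ)
    have h1 := ((hcd.continuous_fderiv one_ne_zero).clm_apply
      (continuous_const (y := coordVec μ))).integrable_of_hasCompactSupport
        (μ := MeasureTheory.volume) (hcs.fderiv_apply ℝ (coordVec μ))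
    rw [fderiv_indicator_of_eq_zero isOpen_openDiamond hK.isClosed hKO (hg0 μ)] at h1
    refine h1.congr (Filter.Eventually.of_forall fun z => ?_)
    by_cases hz : z ∈ openDiamond <;> simp [hz, pd]
  have hE0 : ∀ z, 0 ≤ energyCurrent M u 0 z := fun z =>
    Finset.sum_nonneg fun k _ => real_inner_self_nonneg
  have hw0 : ∀ z, 0 ≤ energyWeight κ η z := fun z =>
    mul_nonneg (Real.exp_pos _).le (expNegInvGlue.nonneg _)
  -- The divergence of the weighted current is at most minus the weighted energy density, whereas
  -- its integral is zero.
  have hpt : ∀ z ∈ openDiamond, ∑ μ, pd μ (g μ) z ≤ -g 0 z := by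
    intro z hz
    have hprod : ∀ μ, pd μ (g μ) z = energyWeight κ η z * pd μ (energyCurrent M u μ) z
        + pd μ (energyWeight κ η) z * energyCurrent M u μ z := by
      intro μ
      simp only [pd, g]
      rw [fderiv_fun_mul ((contDiff_energyWeight κ η).differentiable one_ne_zero z)
        ((contDiff_energyCurrent M hu μ).differentiable one_ne_zero z)]
      simp only [add_apply, smul_apply, smul_eq_mul]
      ring
    rw [Finset.sum_congr rfl fun μ _ => hprod μ, Finset.sum_add_distrib, ← Finset.mul_sum,
      sum_pd_energyCurrent hM hu]
    have hres : ∑ k, 2 * inner ℝ (u k z)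
        (pd 0 (u k) z - ∑ i : Fin 3, ∑ l, M i k l • pd i.succ (u l) z)
        ≤ (κ - 1) * energyCurrent M u 0 z := by
      calc _ ≤ ∑ k, 2 * (‖u k z‖ * (C * ∑ l, ‖u l z‖)) := by
            gcongr with k _
            exact (real_inner_le_norm _ _).trans (by gcongr; exact hC z hz k)
        _ = 2 * C * (∑ k, ‖u k z‖) ^ 2 := by
            rw [← Finset.mul_sum, ← Finset.sum_mul]; ring
        _ ≤ 2 * C * (Fintype.card ι * ∑ k, ‖u k z‖ ^ 2) := by
            gcongr
            exact sq_sum_le_card_mul_sum_sq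
        _ = (κ - 1) * energyCurrent M u 0 z := by
            simp only [energyCurrent, Fin.cons_zero, real_inner_self_eq_norm_sq, hκ]
            ring
    have htpos : 0 < 1 - z.1 := (norm_nonneg z.2).trans_lt hz.2
    have hflux : ∑ i : Fin 3, z.2 i * ∑ k, ∑ l, M i k l * inner ℝ (u k z) (u l z)
        ≤ (1 - z.1) * energyCurrent M u 0 z := by
      -- The vector x / (1 - t) has length at most 1 in the diamond, so the bound on the speed gives
      -- the flux through the hyperboloids its sign.
      have h1 := hspeed (fun i => z.2 i / (1 - z.1)) (fun k => u k z) (by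
        simp only [div_pow]
        rw [← Finset.sum_div, div_le_one (by positivity), ← EuclideanSpace.real_norm_sq_eq]
        gcongr
        exact hz.2.le)
      have h2 := mul_le_mul_of_nonneg_left h1 htpos.le
      refine le_trans (le_of_eq ?_) h2
      rw [Finset.mul_sum]
      refine Finset.sum_congr rfl fun i _ => ?_
      field_simp
    have hD : 0 ≤ Real.exp (-κ * z.1) * deriv expNegInvGlue (coneFun η z) :=
      mul_nonneg (Real.exp_pos _).le expNegInvGlue.monotone.deriv_nonneg
    have hsum : ∑ μ, pd μ (energyWeight κ η) z * energyCurrent M u μ z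
        = -κ * energyWeight κ η z * energyCurrent M u 0 z
          - 2 * (Real.exp (-κ * z.1) * deriv expNegInvGlue (coneFun η z)) *
            ((1 - z.1) * energyCurrent M u 0 z
              - ∑ i : Fin 3, z.2 i * ∑ k, ∑ l, M i k l * inner ℝ (u k z) (u l z)) := by
      rw [Fin.sum_univ_succ, pd_energyWeight_zero]
      simp only [pd_energyWeight_succ]
      have : ∀ i : Fin 3, energyCurrent M u i.succ z
        = -∑ k, ∑ l, M i k l * inner ℝ (u k z) (u l z) := fun i => rfl
      simp only [this]
      rw [mul_sub (2 * _), Finset.mul_sum, Finset.sum_congr rfl (g := fun i : Fin 3 =>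
        2 * (Real.exp (-κ * z.1) * deriv expNegInvGlue (coneFun η z)) *
          (z.2 i * ∑ k, ∑ l, M i k l * inner ℝ (u k z) (u l z))) fun i _ => by ring]
      ring
    rw [hsum]
    have h1 := mul_le_mul_of_nonneg_left hres (hw0 z)
    have h2 := mul_nonneg (mul_nonneg zero_le_two hD) (sub_nonneg.2 hflux)
    simp only [g]
    linarith
  have hcont0 : Continuous (openDiamond.indicator (g 0)) :=
    (contDiff_indicator_of_eq_zero (hg 0) isOpen_openDiamond hK.isClosed hKO (hg0 0)).continuous
  have hint0 : MeasureTheory.Integrable (openDiamond.indicator (g 0)) :=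
    hcont0.integrable_of_hasCompactSupport (hasCompactSupport_indicator_of_eq_zero hK (hg0 0))
  have hnn : ∀ z, 0 ≤ openDiamond.indicator (g 0) z := fun z =>
    indicator_nonneg (fun y _ => mul_nonneg (hw0 y) (hE0 y)) z
  have hle : ∫ z, openDiamond.indicator (g 0) z ≤ 0 := by
    have h1 : ∫ z, ∑ μ, openDiamond.indicator (pd μ (g μ)) z = 0 := by
      rw [MeasureTheory.integral_finsetSum _ fun μ _ => hint μ]
      simp [hind]
    have h2 : ∫ z, ∑ μ, openDiamond.indicator (pd μ (g μ)) z
        ≤ ∫ z, -openDiamond.indicator (g 0) z := by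
      refine MeasureTheory.integral_mono (MeasureTheory.integrable_finsetSum _ fun μ _ => hint μ)
        hint0.neg fun z => ?_
      by_cases hz : z ∈ openDiamond
      · simpa [hz] using hpt z hz
      · simp [hz]
    rw [h1, MeasureTheory.integral_neg] at h2
    linarith
  have hzero : openDiamond.indicator (g 0) = 0 := by
    have h1 := (MeasureTheory.integral_eq_zero_iff_of_nonneg hnn hint0).1
      (le_antisymm hle (MeasureTheory.integral_nonneg hnn))
    exact (hcont0.ae_eq_iff_eq MeasureTheory.volume continuous_const).1 h1
  have hz0 : g 0 z₀ = 0 := by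
    rw [← indicator_of_mem hz₀ (g 0), hzero]
    rfl
  have hwpos : 0 < energyWeight κ η z₀ := by
    refine mul_pos (Real.exp_pos _) (expNegInvGlue.pos_of_pos ?_)
    simp only [coneFun]
    linarith
  have hE : energyCurrent M u 0 z₀ = 0 := (mul_eq_zero.1 hz0).resolve_left hwpos.ne'
  intro k
  have := (Finset.sum_eq_zero_iff_of_nonneg fun k _ => real_inner_self_nonneg).1 hE k
    (Finset.mem_univ k)
  exact inner_self_eq_zero.1 this

end Energy

/-! ### The Hodge star in coordinates -/

section Hodge

/-- The determinant of a `4 × 4` matrix with entries `m a b`, expanded along the first rows. -/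
def detFour {R : Type*} [CommRing R] (m : Fin 4 → Fin 4 → R) : R :=
  (m 0 0 * m 1 1 - m 0 1 * m 1 0) * (m 2 2 * m 3 3 - m 2 3 * m 3 2)
  - (m 0 0 * m 1 2 - m 0 2 * m 1 0) * (m 2 1 * m 3 3 - m 2 3 * m 3 1)
  + (m 0 0 * m 1 3 - m 0 3 * m 1 0) * (m 2 1 * m 3 2 - m 2 2 * m 3 1)
  + (m 0 1 * m 1 2 - m 0 2 * m 1 1) * (m 2 0 * m 3 3 - m 2 3 * m 3 0)
  - (m 0 1 * m 1 3 - m 0 3 * m 1 1) * (m 2 0 * m 3 2 - m 2 2 * m 3 0)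
  + (m 0 2 * m 1 3 - m 0 3 * m 1 2) * (m 2 0 * m 3 1 - m 2 1 * m 3 0)

theorem det_eq_detFour {R : Type*} [CommRing R] (m : Fin 4 → Fin 4 → R) :
    Matrix.det (Matrix.of m) = detFour m := by
  rw [Matrix.det_succ_row_zero]
  simp [Fin.sum_univ_succ, Matrix.det_fin_three, Fin.succAbove, detFour]
  ring

/-- The Levi-Civita symbol. -/
def leviCivita (a b c d : Fin 4) : ℤ :=
  detFour fun r s => if ![a, b, c, d] r = s then 1 else 0

theorem coords_coordVec (a b : Fin 4) : coords (coordVec a) b = if a = b then 1 else 0 := by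
  refine Fin.cases ?_ (fun i => ?_) a <;> refine Fin.cases ?_ (fun j => ?_) b
  · simp [coords, coordVec]
  · simp [coords, coordVec, (Fin.succ_ne_zero j).symm]
  · simp [coords, coordVec]
  · simp [coords, coordVec, eq_comm]

/-- All entries of the determinant are 0 or 1, so it can be evaluated over the integers and cast. -/
theorem vol_coordVec (a b c d : Fin 4) :
    vol ![coordVec a, coordVec b, coordVec c, coordVec d] = leviCivita a b c d := by
  unfold vol leviCivita
  have hcast : ∀ m : Fin 4 → Fin 4 → ℤ, ((detFour m : ℤ) : ℝ) = detFour fun r s => (m r s : ℝ) := by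
    intro m; simp [detFour]
  rw [det_eq_detFour, hcast]
  congr 1
  ext r s
  have hr : ![coordVec a, coordVec b, coordVec c, coordVec d] r = coordVec (![a, b, c, d] r) := by
    fin_cases r <;> rfl
  rw [hr, coords_coordVec]
  split_ifs <;> simp

theorem joinVec_two_two (v : Fin 2 → Spacetime) (w : Fin 2 → Spacetime) :
    joinVec (k := 2) (m := 2) rfl v w = ![v 0, v 1, w 0, w 1] := by
  ext1 a
  fin_cases a <;> rfl

theorem joinVec_three_one (v : Fin 3 → Spacetime) (w : Fin 1 → Spacetime) :
    joinVec (k := 3) (m := 1) rfl v w = ![v 0, v 1, v 2, w 0] := by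
  ext1 a
  fin_cases a <;> rfl

variable {F : Type*} [NormedAddCommGroup F] [NormedSpace ℝ F]

theorem hodgeStar_apply {k m : ℕ} (h : k + m = 4) (η : Spacetime [⋀^Fin k]→L[ℝ] F)
    (v : Fin m → Spacetime) :
    hodgeStar h η v = ((k.factorial : ℝ)⁻¹) • ∑ i : Fin k → Fin 4, (∏ a, metricDiag (i a)) •
      vol (joinVec h (fun a => coordVec (i a)) v) • η fun a => coordVec (i a) := by
  simp only [hodgeStar, ContinuousAlternatingMap.smul_apply, ContinuousAlternatingMap.sum_apply]
  rfl

theorem sum_fin_two_arrow {α V : Type*} [Fintype α] [AddCommMonoid V] (f : (Fin 2 → α) → V) :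
    ∑ i, f i = ∑ a, ∑ b, f ![a, b] := by
  rw [← Fintype.sum_prod_type' (f := fun a b => f ![a, b])]
  exact Fintype.sum_equiv (finTwoArrowEquiv α) _ _ fun i => by
    congr 1; ext a; fin_cases a <;> rfl

theorem sum_fin_three_arrow {α V : Type*} [Fintype α] [AddCommMonoid V] (f : (Fin 3 → α) → V) :
    ∑ i, f i = ∑ a, ∑ b, ∑ c, f ![a, b, c] := by
  have h : ∀ a, ∑ b, ∑ c, f ![a, b, c] = ∑ j : Fin 2 → α, f (Fin.cons a j) := fun a =>
    (sum_fin_two_arrow fun j : Fin 2 → α => f (Fin.cons a j)).symm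
  simp only [h]
  rw [← Fintype.sum_prod_type' (f := fun a (j : Fin 2 → α) => f (Fin.cons a j))]
  exact (Fintype.sum_equiv (Fin.consEquiv fun _ : Fin 3 => α) _ _ fun i => rfl).symm

theorem hodgeStar_three_apply (η : Spacetime [⋀^Fin 3]→L[ℝ] F) (d : Fin 4) :
    hodgeStar (k := 3) (m := 1) rfl η ![coordVec d] = (6 : ℝ)⁻¹ •
      ∑ a, ∑ b, ∑ c, (metricDiag a * metricDiag b * metricDiag c * leviCivita a b c d) •
        η ![coordVec a, coordVec b, coordVec c] := by
  rw [hodgeStar_apply, sum_fin_three_arrow]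
  have h2 : ∀ a b c : Fin 4, (fun k => coordVec (![a, b, c] k))
      = ![coordVec a, coordVec b, coordVec c] := by
    intro a b c; ext1 k; fin_cases k <;> rfl
  simp [joinVec_three_one, vol_coordVec, h2, Nat.factorial, smul_smul, Fin.prod_univ_three]

theorem alternating_three_swap_left (η : Spacetime [⋀^Fin 3]→L[ℝ] F) (x y z : Spacetime) :
    η ![y, x, z] = -η ![x, y, z] := by
  have h : ![y, x, z] = ![x, y, z] ∘ Equiv.swap 0 1 := by
    ext1 k; fin_cases k <;> simp [Equiv.swap_apply_def]
  rw [h]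
  exact η.toAlternatingMap.map_swap _ (by decide)

theorem alternating_three_swap_right (η : Spacetime [⋀^Fin 3]→L[ℝ] F) (x y z : Spacetime) :
    η ![x, z, y] = -η ![x, y, z] := by
  have h : ![x, z, y] = ![x, y, z] ∘ Equiv.swap 1 2 := by
    ext1 k; fin_cases k <;> simp [Equiv.swap_apply_def]
  rw [h]
  exact η.toAlternatingMap.map_swap _ (by decide)

theorem alternating_three_antisymmetrize (η : Spacetime [⋀^Fin 3]→L[ℝ] F) (x y z : Spacetime) :
    η ![x, y, z] - η ![x, z, y] - η ![y, x, z] + η ![y, z, x] + η ![z, x, y] - η ![z, y, x]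
      = (6 : ℝ) • η ![x, y, z] := by
  rw [alternating_three_swap_right η z x y, alternating_three_swap_left η x z y,
    alternating_three_swap_right η y x z, alternating_three_swap_right η x y z,
    alternating_three_swap_left η x y z]
  module

/-- Evaluated on ∂_d, the star of a 3-form is, up to sign, its component on the three complementary
indices. Only triples containing the time index are needed: they carry the spatial Yang–Mills
equations, and the constraint on the triple (1, 2, 3) plays no role later. -/
theorem alternating_three_eq_zero_of_hodgeStar_eq_zero {η : Spacetime [⋀^Fin 3]→L[ℝ] F}
    (h : hodgeStar (k := 3) (m := 1) rfl η = 0) :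
    η ![coordVec 0, coordVec 1, coordVec 2] = 0 ∧ η ![coordVec 0, coordVec 1, coordVec 3] = 0 ∧
      η ![coordVec 0, coordVec 2, coordVec 3] = 0 := by
  have hz : ∀ d : Fin 4, ∑ a, ∑ b, ∑ c, (metricDiag a * metricDiag b * metricDiag c *
      leviCivita a b c d) • η ![coordVec a, coordVec b, coordVec c] = 0 := by
    intro d
    have := hodgeStar_three_apply η d
    rw [h] at this
    simpa using this.symm
  have key : ∀ a b c : Fin 4, (6 : ℝ) • η ![coordVec a, coordVec b, coordVec c] = 0 →
      η ![coordVec a, coordVec b, coordVec c] = 0 := fun a b c h => by simpa using h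
  have m0 : metricDiag 0 = -1 := rfl
  have m1 : metricDiag 1 = 1 := rfl
  have m2 : metricDiag 2 = 1 := rfl
  have m3 : metricDiag 3 = 1 := rfl
  refine ⟨key _ _ _ ?_, key _ _ _ ?_, key _ _ _ ?_⟩
  · have h3 := hz 3
    simp [Fin.sum_univ_four, leviCivita, detFour, m0, m1, m2, m3] at h3
    rw [← alternating_three_antisymmetrize]
    linear_combination (norm := module) (-1 : ℝ) • h3
  · have h3 := hz 2
    simp [Fin.sum_univ_four, leviCivita, detFour, m0, m1, m2, m3] at h3
    rw [← alternating_three_antisymmetrize]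
    linear_combination (norm := module) (1 : ℝ) • h3
  · have h3 := hz 1
    simp [Fin.sum_univ_four, leviCivita, detFour, m0, m1, m2, m3] at h3
    rw [← alternating_three_antisymmetrize]
    linear_combination (norm := module) (-1 : ℝ) • h3

end Hodge

/-! ### The Yang–Mills equations in coordinates -/

section Components

variable {n : ℕ}

/-- The components `F_{μν} = ∂_μ A_ν - ∂_ν A_μ + [A_μ, A_ν]` of the curvature. -/
noncomputable def curv (A : Fin 4 → Spacetime → Mat n) (μ ν : Fin 4) (z : Spacetime) : Mat n :=
  pd μ (A ν) z - pd ν (A μ) z + (A μ z * A ν z - A ν z * A μ z)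

/-- The covariant derivative `∂_μ X + [A_μ, X]`. -/
noncomputable def covD (A : Fin 4 → Spacetime → Mat n) (μ : Fin 4) (X : Spacetime → Mat n)
    (z : Spacetime) : Mat n :=
  pd μ X z + (A μ z * X z - X z * A μ z)

/-- The components of a 1-form. -/
noncomputable def component (A : Spacetime → Spacetime →L[ℝ] Mat n) (μ : Fin 4)
    (z : Spacetime) : Mat n :=
  A z (coordVec μ)

theorem contDiff_component {A : Spacetime → Spacetime →L[ℝ] Mat n} (hA : ContDiff ℝ ∞ A)
    (μ : Fin 4) : ContDiff ℝ ∞ (component A μ) :=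
  hA.clm_apply contDiff_const

theorem contDiff_pd {V : Type*} [NormedAddCommGroup V] [NormedSpace ℝ V] {f : Spacetime → V}
    (hf : ContDiff ℝ ∞ f) (μ : Fin 4) : ContDiff ℝ ∞ (pd μ f) :=
  (hf.fderiv_right (m := ∞) (by simp)).clm_apply contDiff_const

theorem contDiff_matMul {X Y : Spacetime → Mat n} (hX : ContDiff ℝ ∞ X) (hY : ContDiff ℝ ∞ Y) :
    ContDiff ℝ ∞ fun z => X z * Y z :=
  hX.mul hY

theorem contDiff_curv {A : Fin 4 → Spacetime → Mat n} (hA : ∀ μ, ContDiff ℝ ∞ (A μ))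
    (μ ν : Fin 4) : ContDiff ℝ ∞ (curv A μ ν) :=
  ((contDiff_pd (hA ν) μ).sub (contDiff_pd (hA μ) ν)).add
    ((contDiff_matMul (hA μ) (hA ν)).sub (contDiff_matMul (hA ν) (hA μ)))

theorem matComm_apply (X Y : Mat n) : matComm n X Y = X * Y - Y * X := rfl

theorem removeNth_two (x y : Spacetime) : (0 : Fin 2).removeNth ![x, y] = ![y] ∧
    (1 : Fin 2).removeNth ![x, y] = ![x] := by
  constructor <;> (ext1 k; fin_cases k; rfl)

theorem removeNth_three (x y z : Spacetime) : (0 : Fin 3).removeNth ![x, y, z] = ![y, z] ∧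
    (1 : Fin 3).removeNth ![x, y, z] = ![x, z] ∧ (2 : Fin 3).removeNth ![x, y, z] = ![x, y] := by
  refine ⟨?_, ?_, ?_⟩ <;> (ext1 k; fin_cases k <;> rfl)

theorem formBracket_pair (a : Spacetime →L[ℝ] Mat n) (η : Spacetime [⋀^Fin 1]→L[ℝ] Mat n)
    (x y : Spacetime) : formBracket a η ![x, y] =
      (a x * η ![y] - η ![y] * a x) - (a y * η ![x] - η ![x] * a y) := by
  rw [formBracket, ContinuousAlternatingMap.alternatizeUncurryFin_apply]
  refine (Fin.sum_univ_two _).trans ?_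
  rw [(removeNth_two x y).1, (removeNth_two x y).2]
  simp [matComm_apply]
  abel

theorem formBracket_triple (a : Spacetime →L[ℝ] Mat n) (η : Spacetime [⋀^Fin 2]→L[ℝ] Mat n)
    (x y z : Spacetime) : formBracket a η ![x, y, z] =
      (a x * η ![y, z] - η ![y, z] * a x) - (a y * η ![x, z] - η ![x, z] * a y)
        + (a z * η ![x, y] - η ![x, y] * a z) := by
  rw [formBracket, ContinuousAlternatingMap.alternatizeUncurryFin_apply]
  refine (Fin.sum_univ_three _).trans ?_
  rw [(removeNth_three x y z).1, (removeNth_three x y z).2.1, (removeNth_three x y z).2.2]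
  simp [matComm_apply]
  abel

/-- The form is smooth across the boundary and the diamond has unique derivatives, so derivatives
within the diamond are ordinary ones, even at boundary points. -/
theorem extDerivWithin_pair {θ : Spacetime → Spacetime [⋀^Fin 1]→L[ℝ] Mat n}
    (hθ : ContDiff ℝ ∞ θ) {z : Spacetime} (hz : z ∈ diamond) (x y : Spacetime) :
    extDerivWithin θ diamond z ![x, y]
      = fderiv ℝ (fun p => θ p ![y]) z x - fderiv ℝ (fun p => θ p ![x]) z y := by
  have hud := uniqueDiffOn_diamond z hz
  have hd : DifferentiableAt ℝ θ z := hθ.differentiable (by simp) z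
  have he : ∀ v, DifferentiableAt ℝ (fun p => θ p v) z := fun v => by fun_prop
  rw [extDerivWithin_apply hd.differentiableWithinAt hud]
  refine (Fin.sum_univ_two _).trans ?_
  rw [(removeNth_two x y).1, (removeNth_two x y).2, (he _).fderivWithin hud,
    (he _).fderivWithin hud]
  simp [sub_eq_add_neg]

theorem extDerivWithin_triple {θ : Spacetime → Spacetime [⋀^Fin 2]→L[ℝ] Mat n}
    (hθ : ContDiff ℝ ∞ θ) {z : Spacetime} (hz : z ∈ diamond) (x y w : Spacetime) :
    extDerivWithin θ diamond z ![x, y, w]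
      = fderiv ℝ (fun p => θ p ![y, w]) z x - fderiv ℝ (fun p => θ p ![x, w]) z y
        + fderiv ℝ (fun p => θ p ![x, y]) z w := by
  have hud := uniqueDiffOn_diamond z hz
  have hd : DifferentiableAt ℝ θ z := hθ.differentiable (by simp) z
  have he : ∀ v, DifferentiableAt ℝ (fun p => θ p v) z := fun v => by fun_prop
  rw [extDerivWithin_apply hd.differentiableWithinAt hud]
  refine (Fin.sum_univ_three _).trans ?_
  rw [(removeNth_three x y w).1, (removeNth_three x y w).2.1, (removeNth_three x y w).2.2,
    (he _).fderivWithin hud, (he _).fderivWithin hud, (he _).fderivWithin hud]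
  simp [sub_eq_add_neg]

theorem asForm_apply (a : Spacetime →L[ℝ] Mat n) (x : Spacetime) : asForm a ![x] = a x := rfl

theorem contDiff_asForm {A : Spacetime → Spacetime →L[ℝ] Mat n} (hA : ContDiff ℝ ∞ A) :
    ContDiff ℝ ∞ fun y => asForm (A y) :=
  (ContinuousAlternatingMap.ofSubsingletonLIE (𝕜 := ℝ) (E := Spacetime) (F := Mat n)
    (0 : Fin 1)).toContinuousLinearEquiv.contDiff.comp hA

/-- Inside the diamond the extension A' may replace A. The factor ½ cancels against [A, A], which
contains the commutator of the two components twice. -/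
theorem curvature_apply {A A' : Spacetime → Spacetime →L[ℝ] Mat n} (hA' : ContDiff ℝ ∞ A')
    (hAA' : EqOn A A' diamond) {z : Spacetime} (hz : z ∈ diamond) (μ ν : Fin 4) :
    curvature diamond A z ![coordVec μ, coordVec ν] = curv (component A') μ ν z := by
  have h1 : extDerivWithin (fun y => asForm (A y)) diamond z
      = extDerivWithin (fun y => asForm (A' y)) diamond z :=
    extDerivWithin_congr' (fun y hy => by simp only [hAA' hy]) hz
  rw [curvature, h1, hAA' hz, ContinuousAlternatingMap.add_apply,
    ContinuousAlternatingMap.smul_apply, extDerivWithin_pair (contDiff_asForm hA') hz,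
    formBracket_pair]
  have hc : ∀ ν, component A' ν = fun y => A' y (coordVec ν) := fun _ => rfl
  simp only [asForm_apply, curv, pd, hc]
  module

theorem contDiff_toSpanSingleton_comp {V : Type*} [NormedAddCommGroup V] [NormedSpace ℝ V]
    [FiniteDimensional ℝ V] {m : ℕ} (θ : Spacetime [⋀^Fin m]→L[ℝ] ℝ) :
    ContDiff ℝ ∞ fun X : V =>
      (ContinuousLinearMap.toSpanSingleton ℝ X).compContinuousAlternatingMap θ := by
  let ℓ : V →ₗ[ℝ] Spacetime [⋀^Fin m]→L[ℝ] V :=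
    { toFun := fun X => (ContinuousLinearMap.toSpanSingleton ℝ X).compContinuousAlternatingMap θ
      map_add' := fun X Y => by ext; simp
      map_smul' := fun c X => by ext v; exact smul_comm (θ v) c X }
  exact ℓ.toContinuousLinearMap.contDiff

theorem curv_swap (A : Fin 4 → Spacetime → Mat n) (μ ν : Fin 4) (z : Spacetime) :
    curv A ν μ z = -curv A μ ν z := by
  simp only [curv]
  abel

/-- The Hodge star of the curvature is smooth on the diamond. -/
theorem exists_contDiff_hodgeStar_curvature {A A' : Spacetime → Spacetime →L[ℝ] Mat n}
    (hA' : ContDiff ℝ ∞ A') (hAA' : EqOn A A' diamond) :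
    ∃ η : Spacetime → Spacetime [⋀^Fin 2]→L[ℝ] Mat n, ContDiff ℝ ∞ η ∧ EqOn
        (fun y => hodgeStar (k := 2) (m := 2) rfl (curvature diamond A y)) η diamond ∧
      ∀ y c d, η y ![coordVec c, coordVec d] = (2 : ℝ)⁻¹ • ∑ a, ∑ b,
        (metricDiag a * metricDiag b * leviCivita a b c d) • curv (component A') a b y := by
  -- The witness is the star of the curvature of the extension A', written in components; it is
  -- smooth everywhere and agrees with the required form on the diamond.
  refine ⟨fun y => (((2 : ℕ).factorial : ℝ)⁻¹) • ∑ i : Fin 2 → Fin 4, (∏ a, metricDiag (i a)) •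
    (ContinuousLinearMap.toSpanSingleton ℝ
      (curv (component A') (i 0) (i 1) y)).compContinuousAlternatingMap
      (volContract (k := 2) (m := 2) rfl fun a => coordVec (i a)), ?_, ?_, ?_⟩
  · refine ContDiff.const_smul _ (ContDiff.sum fun i _ => ContDiff.const_smul _ ?_)
    exact (contDiff_toSpanSingleton_comp _).comp
      (contDiff_curv (contDiff_component hA') (i 0) (i 1))
  · intro y hy
    simp only [hodgeStar]
    congr 1
    refine Finset.sum_congr rfl fun i _ => ?_
    have h2 : (fun k => coordVec (i k)) = ![coordVec (i 0), coordVec (i 1)] := by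
      ext1 k; fin_cases k <;> rfl
    rw [h2, curvature_apply hA' hAA' hy]
  · intro y c d
    simp only [ContinuousAlternatingMap.smul_apply, ContinuousAlternatingMap.sum_apply]
    rw [sum_fin_two_arrow]
    congr 1
    refine Finset.sum_congr rfl fun a _ => Finset.sum_congr rfl fun b _ => ?_
    change (∏ k, metricDiag (![a, b] k)) • vol (joinVec (k := 2) (m := 2) rfl
      (fun k => coordVec (![a, b] k)) ![coordVec c, coordVec d]) • curv (component A') a b y = _
    rw [joinVec_two_two, smul_smul, Fin.prod_univ_two]
    exact congrArg (· • _) (congrArg (metricDiag a * metricDiag b * ·) (vol_coordVec a b c d))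

/-- The spatial components of the Yang–Mills equations. -/
theorem SolvesYangMills.component_eq {A A' : Spacetime → Spacetime →L[ℝ] Mat n}
    (hYM : SolvesYangMills A) (hA' : ContDiff ℝ ∞ A') (hAA' : EqOn A A' diamond) {z : Spacetime}
    (hz : z ∈ diamond) (j : Fin 3) :
    covD (component A') 0 (curv (component A') 0 j.succ) z
      = ∑ i : Fin 3, covD (component A') i.succ (curv (component A') i.succ j.succ) z := by
  obtain ⟨η, hη, hηeq, hηc⟩ := exists_contDiff_hodgeStar_curvature hA' hAA'
  have hcov : covDeriv diamond A
      (fun y => hodgeStar (k := 2) (m := 2) rfl (curvature diamond A y)) z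
      = extDerivWithin η diamond z + formBracket (A' z) (η z) := by
    rw [covDeriv, extDerivWithin_congr' hηeq hz, hAA' hz]
    exact congrArg (fun θ => extDerivWithin η diamond z + formBracket (A' z) θ) (hηeq hz)
  have h := hYM z hz
  rw [covCoderiv, hcov] at h
  obtain ⟨h012, h013, h023⟩ := alternating_three_eq_zero_of_hodgeStar_eq_zero h
  have m0 : metricDiag 0 = -1 := rfl
  have m1 : metricDiag 1 = 1 := rfl
  have m2 : metricDiag 2 = 1 := rfl
  have m3 : metricDiag 3 = 1 := rfl
  have hdiag : ∀ μ, curv (component A') μ μ = fun _ => 0 := by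
    intro μ; ext1 y; simp [curv]
  have hsw : ∀ μ ν, curv (component A') ν μ = fun y => -curv (component A') μ ν y := by
    intro μ ν; ext1 y; exact curv_swap _ μ ν y
  -- Duality exchanges the magnetic components F_{ij} with the electric components F_{0i}; the
  -- latter pick up an extra sign from g^{00} = -1.
  have S01 : (fun y => η y ![coordVec 0, coordVec 1]) = curv (component A') 2 3 := by
    ext1 y
    rw [hηc]
    simp [Fin.sum_univ_four, leviCivita, detFour, m0, m1, m2, m3, hsw 2 3]
    module
  have S02 : (fun y => η y ![coordVec 0, coordVec 2]) = fun y => -curv (component A') 1 3 y := by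
    ext1 y
    rw [hηc]
    simp [Fin.sum_univ_four, leviCivita, detFour, m0, m1, m2, m3, hsw 1 3]
    module
  have S03 : (fun y => η y ![coordVec 0, coordVec 3]) = curv (component A') 1 2 := by
    ext1 y
    rw [hηc]
    simp [Fin.sum_univ_four, leviCivita, detFour, m0, m1, m2, m3, hsw 1 2]
    module
  have S12 : (fun y => η y ![coordVec 1, coordVec 2]) = fun y => -curv (component A') 0 3 y := by
    ext1 y
    rw [hηc]
    simp [Fin.sum_univ_four, leviCivita, detFour, m0, m1, m2, m3, hsw 0 3]
    module
  have S13 : (fun y => η y ![coordVec 1, coordVec 3]) = curv (component A') 0 2 := by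
    ext1 y
    rw [hηc]
    simp [Fin.sum_univ_four, leviCivita, detFour, m0, m1, m2, m3, hsw 0 2]
    module
  have S23 : (fun y => η y ![coordVec 2, coordVec 3]) = fun y => -curv (component A') 0 1 y := by
    ext1 y
    rw [hηc]
    simp [Fin.sum_univ_four, leviCivita, detFour, m0, m1, m2, m3, hsw 0 1]
    module
  rw [ContinuousAlternatingMap.add_apply, extDerivWithin_triple hη hz, formBracket_triple]
    at h012 h013 h023
  have e0 : ∀ μ, covD (component A') μ (fun _ => 0) z = 0 := by
    intro μ; simp [covD, pd]
  have en : ∀ μ (X : Spacetime → Mat n), covD (component A') μ (fun y => -X y) z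
      = -covD (component A') μ X z := by
    intro μ X
    simp only [covD, pd]
    rw [fderiv_fun_neg]
    simp
    abel
  have hd : ∀ (X Y W : Spacetime → Mat n) (a b c : Fin 4),
      fderiv ℝ X z (coordVec a) - fderiv ℝ Y z (coordVec b) + fderiv ℝ W z (coordVec c)
        + ((A' z (coordVec a) * X z - X z * A' z (coordVec a))
          - (A' z (coordVec b) * Y z - Y z * A' z (coordVec b))
          + (A' z (coordVec c) * W z - W z * A' z (coordVec c)))
        = covD (component A') a X z - covD (component A') b Y z + covD (component A') c W z := by
    intro X Y W a b c
    simp only [covD, pd, component]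
    abel
  -- Each triple (0, i, j) of d_A ⋆F = 0 is the equation for the remaining spatial index.
  have h012' := (hd _ _ _ 0 1 2).symm.trans h012
  have h013' := (hd _ _ _ 0 1 3).symm.trans h013
  have h023' := (hd _ _ _ 0 2 3).symm.trans h023
  rw [S12, S02, S01, en, en] at h012'
  rw [S13, S03, S01, ] at h013'
  rw [S23, S03, S02, en, en] at h023'
  rw [Fin.sum_univ_three]
  fin_cases j
  · change covD (component A') 0 (curv (component A') 0 1) z
      = covD (component A') 1 (curv (component A') 1 1) z
        + covD (component A') 2 (curv (component A') 2 1) z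
        + covD (component A') 3 (curv (component A') 3 1) z
    rw [hdiag, hsw 1 2, hsw 1 3, e0, en, en]
    linear_combination (norm := module) (-1 : ℝ) • h023'
  · change covD (component A') 0 (curv (component A') 0 2) z
      = covD (component A') 1 (curv (component A') 1 2) z
        + covD (component A') 2 (curv (component A') 2 2) z
        + covD (component A') 3 (curv (component A') 3 2) z
    rw [hdiag, hsw 2 3, e0, en]
    linear_combination (norm := module) (1 : ℝ) • h013'
  · change covD (component A') 0 (curv (component A') 0 3) z
      = covD (component A') 1 (curv (component A') 1 3) z
        + covD (component A') 2 (curv (component A') 2 3) z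
        + covD (component A') 3 (curv (component A') 3 3) z
    rw [hdiag, e0]
    linear_combination (norm := module) (-1 : ℝ) • h012'

end Components

/-! ### The intertwining of two connections -/

section Twisted

variable {n : ℕ}

theorem pd_add {X Y : Spacetime → Mat n} (hX : ContDiff ℝ ∞ X) (hY : ContDiff ℝ ∞ Y) (μ : Fin 4)
    (z : Spacetime) : pd μ (fun z => X z + Y z) z = pd μ X z + pd μ Y z := by
  rw [pd, fderiv_fun_add (hX.differentiable (by simp) z) (hY.differentiable (by simp) z)]
  rfl

theorem pd_sub {X Y : Spacetime → Mat n} (hX : ContDiff ℝ ∞ X) (hY : ContDiff ℝ ∞ Y) (μ : Fin 4)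
    (z : Spacetime) : pd μ (fun z => X z - Y z) z = pd μ X z - pd μ Y z := by
  rw [pd, fderiv_fun_sub (hX.differentiable (by simp) z) (hY.differentiable (by simp) z)]
  rfl

theorem pd_mul {X Y : Spacetime → Mat n} (hX : ContDiff ℝ ∞ X) (hY : ContDiff ℝ ∞ Y) (μ : Fin 4)
    (z : Spacetime) : pd μ (fun z => X z * Y z) z = pd μ X z * Y z + X z * pd μ Y z := by
  have := (hX.differentiable (by simp) z).hasFDerivAt.mul'
    (hY.differentiable (by simp) z).hasFDerivAt
  have h2 := congrArg (fun ℓ => ℓ (coordVec μ)) this.fderiv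
  rw [add_comm]
  exact h2

theorem pd_comm {X : Spacetime → Mat n} (hX : ContDiff ℝ ∞ X) (μ ν : Fin 4) (z : Spacetime) :
    pd μ (pd ν X) z = pd ν (pd μ X) z := by
  have hd : DifferentiableAt ℝ (fderiv ℝ X) z :=
    (hX.fderiv_right (m := ∞) (by simp)).differentiable (by simp) z
  have h : ∀ μ ν : Fin 4, pd μ (pd ν X) z = fderiv ℝ (fderiv ℝ X) z (coordVec μ) (coordVec ν) := by
    intro μ ν
    have h1 := (hd.hasFDerivAt.clm_apply (hasFDerivAt_const (coordVec ν) z)).fderiv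
    have h2 := congrArg (fun ℓ => ℓ (coordVec μ)) h1
    have hp : pd ν X = fun y => fderiv ℝ X y (coordVec ν) := rfl
    rw [pd, hp]
    simpa using h2
  rw [h, h]
  exact ((contDiff_infty.1 hX 2).contDiffAt.isSymmSndFDerivAt (by simp)) _ _

/-- The covariant derivative `∂_μ X + A_μ X - X B_μ` of an intertwiner between the connections `A`
and `B`. -/
noncomputable def twistD (A B : Fin 4 → Spacetime → Mat n) (μ : Fin 4) (X : Spacetime → Mat n)
    (z : Spacetime) : Mat n :=
  pd μ X z + (A μ z * X z - X z * B μ z)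

/-- The difference `F^A_{μν} U - U F^B_{μν}` of the curvatures. -/
noncomputable def twistCurv (A B : Fin 4 → Spacetime → Mat n) (U : Spacetime → Mat n) (μ ν : Fin 4)
    (z : Spacetime) : Mat n :=
  curv A μ ν z * U z - U z * curv B μ ν z

variable {A B : Fin 4 → Spacetime → Mat n} {U : Spacetime → Mat n}

theorem contDiff_twistD (hA : ∀ μ, ContDiff ℝ ∞ (A μ)) (hB : ∀ μ, ContDiff ℝ ∞ (B μ))
    (hU : ContDiff ℝ ∞ U) (μ : Fin 4) : ContDiff ℝ ∞ (twistD A B μ U) :=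
  (contDiff_pd hU μ).add ((contDiff_matMul (hA μ) hU).sub (contDiff_matMul hU (hB μ)))

theorem contDiff_twistCurv (hA : ∀ μ, ContDiff ℝ ∞ (A μ)) (hB : ∀ μ, ContDiff ℝ ∞ (B μ))
    (hU : ContDiff ℝ ∞ U) (μ ν : Fin 4) : ContDiff ℝ ∞ (twistCurv A B U μ ν) :=
  (contDiff_matMul (contDiff_curv hA μ ν) hU).sub (contDiff_matMul hU (contDiff_curv hB μ ν))

theorem pd_twistD (hA : ∀ μ, ContDiff ℝ ∞ (A μ)) (hB : ∀ μ, ContDiff ℝ ∞ (B μ))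
    (hU : ContDiff ℝ ∞ U) (μ ν : Fin 4) (z : Spacetime) : pd μ (twistD A B ν U) z =
      pd μ (pd ν U) z + ((pd μ (A ν) z * U z + A ν z * pd μ U z)
        - (pd μ U z * B ν z + U z * pd μ (B ν) z)) := by
  have h1 := contDiff_matMul (hA ν) hU
  have h2 := contDiff_matMul hU (hB ν)
  have h := pd_add (contDiff_pd hU ν) (h1.sub h2) μ z
  rw [pd_sub h1 h2, pd_mul (hA ν) hU, pd_mul hU (hB ν)] at h
  exact h

/-- The curvature of the connection with A on the left and B on the right acts on U as F^A U - U
F^B. Second derivatives of U cancel by symmetry. -/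
theorem twistCurv_eq (hA : ∀ μ, ContDiff ℝ ∞ (A μ)) (hB : ∀ μ, ContDiff ℝ ∞ (B μ))
    (hU : ContDiff ℝ ∞ U) (μ ν : Fin 4) (z : Spacetime) : twistCurv A B U μ ν z =
      twistD A B μ (twistD A B ν U) z - twistD A B ν (twistD A B μ U) z := by
  have h1 : ∀ μ ν, twistD A B μ (twistD A B ν U) z = pd μ (twistD A B ν U) z
      + (A μ z * twistD A B ν U z - twistD A B ν U z * B μ z) := fun _ _ => rfl
  rw [h1, h1, pd_twistD hA hB hU, pd_twistD hA hB hU, pd_comm hU ν μ]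
  simp only [twistCurv, twistD, curv]
  noncomm_ring

/-- Leibniz rule for the three connections involved. The last bracket contains D_ρ U
undifferentiated, which is why D_i U has to be carried along as an unknown. -/
theorem twistD_twistCurv (hA : ∀ μ, ContDiff ℝ ∞ (A μ)) (hB : ∀ μ, ContDiff ℝ ∞ (B μ))
    (hU : ContDiff ℝ ∞ U) (ρ μ ν : Fin 4) (z : Spacetime) :
    twistD A B ρ (twistCurv A B U μ ν) z =
      covD A ρ (curv A μ ν) z * U z - U z * covD B ρ (curv B μ ν) z
        + (curv A μ ν z * twistD A B ρ U z - twistD A B ρ U z * curv B μ ν z) := by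
  have hFA := contDiff_curv hA μ ν
  have hFB := contDiff_curv hB μ ν
  have h := pd_sub (contDiff_matMul hFA hU) (contDiff_matMul hU hFB) ρ z
  rw [pd_mul hFA hU, pd_mul hU hFB] at h
  have h' : pd ρ (twistCurv A B U μ ν) z = _ := h
  rw [twistD, h']
  simp only [twistCurv, twistD, covD]
  noncomm_ring

theorem pd_curv (hA : ∀ μ, ContDiff ℝ ∞ (A μ)) (ρ μ ν : Fin 4) (z : Spacetime) :
    pd ρ (curv A μ ν) z = pd ρ (pd μ (A ν)) z - pd ρ (pd ν (A μ)) z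
      + ((pd ρ (A μ) z * A ν z + A μ z * pd ρ (A ν) z)
        - (pd ρ (A ν) z * A μ z + A ν z * pd ρ (A μ) z)) := by
  have h1 := contDiff_pd (hA ν) μ
  have h2 := contDiff_pd (hA μ) ν
  have h3 := contDiff_matMul (hA μ) (hA ν)
  have h4 := contDiff_matMul (hA ν) (hA μ)
  have h := pd_add (h1.sub h2) (h3.sub h4) ρ z
  rw [pd_sub h1 h2, pd_sub h3 h4, pd_mul (hA μ) (hA ν), pd_mul (hA ν) (hA μ)] at h
  exact h

/-- The Bianchi identity. -/
theorem bianchi (hA : ∀ μ, ContDiff ℝ ∞ (A μ)) (ρ μ ν : Fin 4) (z : Spacetime) :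
    covD A ρ (curv A μ ν) z + covD A μ (curv A ν ρ) z + covD A ν (curv A ρ μ) z = 0 := by
  simp only [covD, pd_curv hA]
  rw [pd_comm (hA ν) μ ρ, pd_comm (hA μ) ν ρ, pd_comm (hA ρ) ν μ]
  simp only [curv]
  noncomm_ring

end Twisted

/-! ### The Maxwell system -/

section Maxwell

/-- The coefficients of the first-order system `∂_t e = -curl b`, `∂_t b = curl e` for the fields
`(a, e, b)` in `ℝ³ × ℝ³ × ℝ³`. -/
def maxwellCoeff (i : Fin 3) (k l : Fin 9) : ℤ :=
  match i.val, k.val, l.val with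
  | 0, 4, 8 => 1
  | 0, 8, 4 => 1
  | 0, 5, 7 => -1
  | 0, 7, 5 => -1
  | 1, 3, 8 => -1
  | 1, 8, 3 => -1
  | 1, 5, 6 => 1
  | 1, 6, 5 => 1
  | 2, 3, 7 => 1
  | 2, 7, 3 => 1
  | 2, 4, 6 => -1
  | 2, 6, 4 => -1
  | _, _, _ => 0

theorem maxwellCoeff_symm : ∀ i k l, maxwellCoeff i k l = maxwellCoeff i l k := by
  decide

theorem sum_fin_nine {V : Type*} [AddCommMonoid V] (f : Fin 9 → V) :
    ∑ k, f k = f 0 + f 1 + f 2 + f 3 + f 4 + f 5 + f 6 + f 7 + f 8 := by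
  simp [Fin.sum_univ_succ, add_assoc]

/-- With e = (v 3, v 4, v 5) and b = (v 6, v 7, v 8) the form is 2 e · (b × ξ), at most |e|² + |b ×
ξ|². Lagrange's identity |b × ξ|² = |ξ|² |b|² - |ξ · b|² bounds the last term by |b|². The squares
`s1`–`s3` give the first estimate, `s4` and `s5` the second. -/
theorem maxwellCoeff_speed {H : Type*} [NormedAddCommGroup H] [InnerProductSpace ℝ H]
    (ξ : Fin 3 → ℝ) (v : Fin 9 → H) (hξ : ∑ i, ξ i ^ 2 ≤ 1) :
    ∑ i, ξ i * ∑ k, ∑ l, (maxwellCoeff i k l : ℝ) * inner ℝ (v k) (v l)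
      ≤ ∑ k, inner ℝ (v k) (v k) := by
  simp only [sum_fin_nine, Fin.sum_univ_three] at hξ ⊢
  simp only [maxwellCoeff]
  simp only [Fin.isValue, Fin.coe_ofNat_eq_mod, Nat.reduceMod, Int.cast_zero, Int.cast_one,
    Int.cast_neg, zero_mul, one_mul, neg_mul, add_zero, zero_add]
  have h0 := real_inner_self_nonneg (x := v 0)
  have h1 := real_inner_self_nonneg (x := v 1)
  have h2 := real_inner_self_nonneg (x := v 2)
  have h6 := real_inner_self_nonneg (x := v 6)
  have h7 := real_inner_self_nonneg (x := v 7)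
  have h8 := real_inner_self_nonneg (x := v 8)
  have s1 := real_inner_self_nonneg (x := v 3 - (ξ 2 • v 7 - ξ 1 • v 8))
  have s2 := real_inner_self_nonneg (x := v 4 - (ξ 0 • v 8 - ξ 2 • v 6))
  have s3 := real_inner_self_nonneg (x := v 5 - (ξ 1 • v 6 - ξ 0 • v 7))
  have s4 := real_inner_self_nonneg (x := ξ 0 • v 6 + ξ 1 • v 7 + ξ 2 • v 8)
  have s5 := mul_nonneg (sub_nonneg.2 hξ) (add_nonneg (add_nonneg h6 h7) h8)
  simp only [inner_sub_left, inner_sub_right, inner_add_left, inner_add_right, inner_smul_left,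
    inner_smul_right, RCLike.conj_to_real, real_inner_comm (v 3) (v 7), real_inner_comm (v 3) (v 8),
    real_inner_comm (v 4) (v 6), real_inner_comm (v 4) (v 8), real_inner_comm (v 5) (v 6),
    real_inner_comm (v 5) (v 7), real_inner_comm (v 6) (v 7), real_inner_comm (v 6) (v 8),
    real_inner_comm (v 7) (v 8)] at *
  linarith

theorem sum_maxwellCoeff_smul {V : Type*} [AddCommGroup V] [Module ℝ V] (D : Fin 3 → Fin 9 → V)
    (k : Fin 9) : ∑ i, ∑ l, (maxwellCoeff i k l : ℝ) • D i l =
      ![0, 0, 0, -D 1 8 + D 2 7, D 0 8 + -D 2 6, -D 0 7 + D 1 6, D 1 5 + -D 2 4, -D 0 5 + D 2 3,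
        D 0 4 + -D 1 3] k := by
  simp only [sum_fin_nine, Fin.sum_univ_three]
  fin_cases k <;>
  · simp only [maxwellCoeff]
    simp only [Fin.isValue, Fin.coe_ofNat_eq_mod, Nat.reduceMod, Int.cast_zero, Int.cast_one,
      Int.cast_neg, zero_smul, one_smul, neg_smul, add_zero, zero_add]
    rfl

end Maxwell

/-! ### Uniqueness for the difference of two Yang–Mills fields -/

section Uniqueness

open Asymptotics Filter

variable {n : ℕ} {A B : Fin 4 → Spacetime → Mat n} {U : Spacetime → Mat n}

theorem twistD_eq_zero_of_eq_zero {O : Set Spacetime} (hO : IsOpen O) {X : Spacetime → Mat n}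
    (hX : ∀ z ∈ O, X z = 0) (μ : Fin 4) {z : Spacetime} (hz : z ∈ O) : twistD A B μ X z = 0 := by
  have hev : X =ᶠ[nhds z] fun _ => 0 := by
    filter_upwards [hO.mem_nhds hz] with y hy using hX y hy
  simp only [twistD, pd, hev.fderiv_eq, hX z hz]
  simp

/-- The zeroth-order expression `C X - X D`. -/
noncomputable def twistMul (C D X : Spacetime → Mat n) (z : Spacetime) : Mat n :=
  C z * X z - X z * D z

/-- Continuous coefficients are bounded on the compact diamond, so terms of order zero are harmless
in the energy estimate. -/
theorem isBigO_twistMul {C D X : Spacetime → Mat n} (hC : Continuous C) (hD : Continuous D)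
    {S : Spacetime → ℝ} (hX : X =O[𝓟 openDiamond] S) :
    twistMul C D X =O[𝓟 openDiamond] S := by
  have hone : ∀ {Y : Spacetime → Mat n}, Continuous Y →
      Y =O[𝓟 openDiamond] fun _ => (1 : ℝ) := by
    intro Y hY
    obtain ⟨K, hK⟩ := isCompact_diamond.exists_bound_of_continuousOn hY.continuousOn
    refine isBigO_principal.2 ⟨K, fun z hz => ?_⟩
    simpa using hK z (openDiamond_subset_diamond hz)
  have h1 : (fun z => C z * X z) =O[𝓟 openDiamond] S := by
    simpa using (hone hC).mul hX
  have h2 : (fun z => X z * D z) =O[𝓟 openDiamond] S := by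
    simpa using hX.mul (hone hD)
  exact h1.sub h2

/-- Since D_0 U = 0, the commutator [D_0, D_μ] U reduces to D_0 D_μ U. This is the transport
equation for D_μ U, with no spatial derivatives. -/
theorem pd_twistD_zero_eq (hA : ∀ μ, ContDiff ℝ ∞ (A μ)) (hB : ∀ μ, ContDiff ℝ ∞ (B μ))
    (hU : ContDiff ℝ ∞ U) (h0 : ∀ z ∈ openDiamond, twistD A B 0 U z = 0) {z : Spacetime}
    (hz : z ∈ openDiamond) (μ : Fin 4) :
    pd 0 (twistD A B μ U) z
      = twistCurv A B U 0 μ z - twistMul (A 0) (B 0) (twistD A B μ U) z := by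
  have h1 := twistCurv_eq hA hB hU 0 μ z
  rw [twistD_eq_zero_of_eq_zero isOpen_openDiamond h0 μ hz] at h1
  rw [h1]
  simp only [twistMul]
  have h2 : twistD A B 0 (twistD A B μ U) z = pd 0 (twistD A B μ U) z
      + (A 0 z * twistD A B μ U z - twistD A B μ U z * B 0 z) := rfl
  rw [h2]
  abel

theorem pd_eq_twistD_sub (X : Spacetime → Mat n) (μ : Fin 4) (z : Spacetime) :
    pd μ X z = twistD A B μ X z - twistMul (A μ) (B μ) X z := by
  simp only [twistD, twistMul]
  abel

/-- The difference of the Yang–Mills equations of two connections. -/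
theorem pd_twistCurv_zero_eq (hA : ∀ μ, ContDiff ℝ ∞ (A μ)) (hB : ∀ μ, ContDiff ℝ ∞ (B μ))
    (hU : ContDiff ℝ ∞ U) {z : Spacetime} (h0 : twistD A B 0 U z = 0) (j : Fin 3)
    (hYA : covD A 0 (curv A 0 j.succ) z = ∑ i : Fin 3, covD A i.succ (curv A i.succ j.succ) z)
    (hYB : covD B 0 (curv B 0 j.succ) z = ∑ i : Fin 3, covD B i.succ (curv B i.succ j.succ) z) :
    pd 0 (twistCurv A B U 0 j.succ) z
      = ∑ i : Fin 3, pd i.succ (twistCurv A B U i.succ j.succ) z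
        + (∑ i : Fin 3, twistMul (A i.succ) (B i.succ) (twistCurv A B U i.succ j.succ) z
          - ∑ i : Fin 3, twistMul (curv A i.succ j.succ) (curv B i.succ j.succ)
              (twistD A B i.succ U) z
          - twistMul (A 0) (B 0) (twistCurv A B U 0 j.succ) z) := by
  -- As D_0 U = 0, the Leibniz rule in time leaves only derivatives of the curvatures, which the
  -- Yang–Mills equations trade for spatial ones.
  rw [pd_eq_twistD_sub (A := A) (B := B), twistD_twistCurv hA hB hU, h0, hYA, hYB]
  have h : ∀ i : Fin 3, pd i.succ (twistCurv A B U i.succ j.succ) z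
      = covD A i.succ (curv A i.succ j.succ) z * U z - U z * covD B i.succ (curv B i.succ j.succ) z
        + twistMul (curv A i.succ j.succ) (curv B i.succ j.succ) (twistD A B i.succ U) z
        - twistMul (A i.succ) (B i.succ) (twistCurv A B U i.succ j.succ) z := by
    intro i
    rw [pd_eq_twistD_sub (A := A) (B := B), twistD_twistCurv hA hB hU]
    rfl
  simp only [h, Finset.sum_sub_distrib, Finset.sum_add_distrib, Finset.sum_mul, Finset.mul_sum,
    mul_zero, zero_mul]
  abel

/-- The difference of the Bianchi identities of two connections. -/
theorem pd_twistCurv_eq (hA : ∀ μ, ContDiff ℝ ∞ (A μ)) (hB : ∀ μ, ContDiff ℝ ∞ (B μ))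
    (hU : ContDiff ℝ ∞ U) {z : Spacetime} (h0 : twistD A B 0 U z = 0) (μ ν : Fin 4) :
    pd 0 (twistCurv A B U μ ν) z
      = pd μ (twistCurv A B U 0 ν) z - pd ν (twistCurv A B U 0 μ) z
        + (twistMul (A μ) (B μ) (twistCurv A B U 0 ν) z
          - twistMul (A ν) (B ν) (twistCurv A B U 0 μ) z
          - twistMul (A 0) (B 0) (twistCurv A B U μ ν) z
          + twistMul (curv A ν 0) (curv B ν 0) (twistD A B μ U) z
          + twistMul (curv A 0 μ) (curv B 0 μ) (twistD A B ν U) z) := by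
  have hsw : pd μ (twistCurv A B U 0 ν) z = -pd μ (twistCurv A B U ν 0) z := by
    have : twistCurv A B U 0 ν = fun y => -twistCurv A B U ν 0 y := by
      ext1 y
      simp only [twistCurv, curv_swap _ ν 0]
      noncomm_ring
    rw [this, pd, fderiv_fun_neg]
    rfl
  have hsw' : twistMul (A μ) (B μ) (twistCurv A B U 0 ν) z
      = -twistMul (A μ) (B μ) (twistCurv A B U ν 0) z := by
    simp only [twistMul, twistCurv, curv_swap _ ν 0]
    noncomm_ring
  have hbA := bianchi hA 0 μ ν z
  have hbB := bianchi hB 0 μ ν z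
  have e1 := twistD_twistCurv hA hB hU 0 μ ν z
  have e2 := twistD_twistCurv hA hB hU μ ν 0 z
  have e3 := twistD_twistCurv hA hB hU ν 0 μ z
  -- In the cyclic sum the Bianchi identities of A and B remove every derivative of the curvatures.
  have hsum : twistD A B 0 (twistCurv A B U μ ν) z + twistD A B μ (twistCurv A B U ν 0) z
      + twistD A B ν (twistCurv A B U 0 μ) z
      = twistMul (curv A ν 0) (curv B ν 0) (twistD A B μ U) z
          + twistMul (curv A 0 μ) (curv B 0 μ) (twistD A B ν U) z := by
    have h1 : (covD A 0 (curv A μ ν) z + covD A μ (curv A ν 0) z + covD A ν (curv A 0 μ) z) * U z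
        - U z * (covD B 0 (curv B μ ν) z + covD B μ (curv B ν 0) z + covD B ν (curv B 0 μ) z)
        = 0 := by
      rw [hbA, hbB, zero_mul, mul_zero, sub_zero]
    rw [e1, e2, e3, h0]
    simp only [twistMul, mul_zero, zero_mul]
    rw [← sub_eq_zero, ← h1]
    noncomm_ring
  rw [hsw, hsw', pd_eq_twistD_sub (A := A) (B := B) _ 0, pd_eq_twistD_sub (A := A) (B := B) _ μ,
    pd_eq_twistD_sub (A := A) (B := B) _ ν]
  rw [add_assoc _ _ (twistMul (curv A 0 μ) (curv B 0 μ) (twistD A B ν U) z), ← hsum]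
  abel

/-- The energy estimate needs an inner product, which the operator norm on matrices does not come
from. A linear isomorphism with a Euclidean space commutes with the scalar coefficients of the
system and changes the bounds only by constants. -/
theorem eq_zero_of_maxwell {V : Type*} [NormedAddCommGroup V] [NormedSpace ℝ V]
    [FiniteDimensional ℝ V] {X : Fin 9 → Spacetime → V} (hX : ∀ k, ContDiff ℝ ∞ (X k)) {δ : ℝ}
    (hδ : 0 < δ)
    (hres : ∀ k, (fun z => pd 0 (X k) z
      - ∑ i : Fin 3, ∑ l, (maxwellCoeff i k l : ℝ) • pd i.succ (X l) z)
        =O[𝓟 openDiamond] fun z => ∑ l, ‖X l z‖)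
    (hlow : ∀ z ∈ openDiamond, z.1 + 1 - ‖z.2‖ < δ → ∀ k, X k z = 0) :
    ∀ z ∈ openDiamond, ∀ k, X k z = 0 := by
  let E := EuclideanSpace ℝ (Fin (Module.finrank ℝ V))
  let Φ : V ≃L[ℝ] E := toEuclidean
  have hpd : ∀ μ k z, pd μ (fun y => Φ (X k y)) z = Φ (pd μ (X k) z) := by
    intro μ k z
    have h := Φ.hasFDerivAt.comp z ((hX k).differentiable (by simp) z).hasFDerivAt
    exact congrArg (fun ℓ => ℓ (coordVec μ)) h.fderiv
  have hres' : ∀ k, ∃ c, ∀ z ∈ openDiamond, ‖pd 0 (fun y => Φ (X k y)) z - ∑ i : Fin 3, ∑ l,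
      (maxwellCoeff i k l : ℝ) • pd i.succ (fun y => Φ (X l y)) z‖
        ≤ c * ∑ l, ‖Φ (X l z)‖ := by
    intro k
    have h1 : (fun z => pd 0 (fun y => Φ (X k y)) z - ∑ i : Fin 3, ∑ l,
        (maxwellCoeff i k l : ℝ) • pd i.succ (fun y => Φ (X l y)) z)
          = fun z => Φ (pd 0 (X k) z
            - ∑ i : Fin 3, ∑ l, (maxwellCoeff i k l : ℝ) • pd i.succ (X l) z) := by
      ext1 z
      simp only [hpd, map_sub, map_sum, map_smul]
    have h2 : (fun z => ∑ l, ‖X l z‖) =O[𝓟 openDiamond] fun z => ∑ l, ‖Φ (X l z)‖ := by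
      refine isBigO_principal.2 ⟨‖(Φ.symm : E →L[ℝ] V)‖, fun z _ => ?_⟩
      rw [Real.norm_of_nonneg (Finset.sum_nonneg fun _ _ => norm_nonneg _),
        Real.norm_of_nonneg (Finset.sum_nonneg fun _ _ => norm_nonneg _), Finset.mul_sum]
      refine Finset.sum_le_sum fun l _ => ?_
      simpa using (Φ.symm : E →L[ℝ] V).le_opNorm (Φ (X l z))
    have h3 := ((Φ : V →L[ℝ] E).isBigO_comp _ _).trans ((hres k).trans h2)
    rw [← ContinuousLinearEquiv.coe_coe] at h1
    obtain ⟨c, hc⟩ := isBigO_principal.1 h3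
    refine ⟨c, fun z hz => ?_⟩
    have h4 := hc z hz
    rw [Real.norm_of_nonneg (Finset.sum_nonneg fun _ _ => norm_nonneg _)] at h4
    exact (congrArg norm (congrFun h1 z)).le.trans h4
  choose c hc using hres'
  have hzero := eq_zero_of_symmetricHyperbolic (M := fun i k l => (maxwellCoeff i k l : ℝ))
    (u := fun k y => Φ (X k y)) (fun i k l => by rw [maxwellCoeff_symm]) maxwellCoeff_speed
    (fun k => (Φ.contDiff.comp (hX k)).of_le (by simp)) (C := ∑ k, |c k|)
    (Finset.sum_nonneg fun _ _ => abs_nonneg _) hδ ?_ ?_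
  · intro z hz k
    simpa using hzero z hz k
  · intro z hz k
    refine (hc k z hz).trans ?_
    gcongr
    exact (le_abs_self _).trans
      (Finset.single_le_sum (f := fun k => |c k|) (fun _ _ => abs_nonneg _) (Finset.mem_univ k))
  · intro z hz hzδ k
    simp [hlow z hz hzδ k]

/-- The fields `a_i = ∇_i U`, `e_i = f_{0i}` and `b = (f_{23}, f_{31}, f_{12})` of an intertwiner. -/
noncomputable def twistFields (A B : Fin 4 → Spacetime → Mat n) (U : Spacetime → Mat n) :
    Fin 9 → Spacetime → Mat n :=
  ![twistD A B 1 U, twistD A B 2 U, twistD A B 3 U, twistCurv A B U 0 1, twistCurv A B U 0 2,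
    twistCurv A B U 0 3, twistCurv A B U 2 3, twistCurv A B U 3 1, twistCurv A B U 1 2]

/-- An intertwiner between two solutions of the Yang–Mills equations that is covariantly constant in
time and, near the lower boundary, in space, is covariantly constant. -/
theorem twistD_eq_zero (hA : ∀ μ, ContDiff ℝ ∞ (A μ)) (hB : ∀ μ, ContDiff ℝ ∞ (B μ))
    (hU : ContDiff ℝ ∞ U)
    (hYA : ∀ z ∈ openDiamond, ∀ j : Fin 3,
      covD A 0 (curv A 0 j.succ) z = ∑ i : Fin 3, covD A i.succ (curv A i.succ j.succ) z)
    (hYB : ∀ z ∈ openDiamond, ∀ j : Fin 3,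
      covD B 0 (curv B 0 j.succ) z = ∑ i : Fin 3, covD B i.succ (curv B i.succ j.succ) z)
    (h0 : ∀ z ∈ openDiamond, twistD A B 0 U z = 0) {δ : ℝ} (hδ : 0 < δ)
    (hlow : ∀ z ∈ openDiamond, z.1 + 1 - ‖z.2‖ < δ → ∀ μ, twistD A B μ U z = 0) :
    ∀ z ∈ openDiamond, ∀ μ, twistD A B μ U z = 0 := by
  -- A common yardstick: every error term below is shown to be O(S), so the nine fields form a
  -- closed system.
  set S : Spacetime → ℝ := fun z => ∑ l, ‖twistFields A B U l z‖ with hS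
  have hfield : ∀ k, twistFields A B U k =O[𝓟 openDiamond] S := by
    intro k
    refine isBigO_principal.2 ⟨1, fun z _ => ?_⟩
    rw [one_mul, Real.norm_of_nonneg (Finset.sum_nonneg fun _ _ => norm_nonneg _)]
    exact Finset.single_le_sum (f := fun l => ‖twistFields A B U l z‖)
      (fun _ _ => norm_nonneg _) (Finset.mem_univ k)
  have ha : ∀ i : Fin 3, twistD A B i.succ U =O[𝓟 openDiamond] S := by
    intro i
    fin_cases i
    · exact hfield 0
    · exact hfield 1
    · exact hfield 2
  have hsw : ∀ μ ν, twistCurv A B U ν μ = fun z => -twistCurv A B U μ ν z := by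
    intro μ ν
    ext1 z
    simp only [twistCurv, curv_swap _ μ ν]
    noncomm_ring
  have hdiag : ∀ μ, twistCurv A B U μ μ = fun _ => 0 := by
    intro μ
    ext1 z
    simp [twistCurv, curv]
  have hf0 : ∀ j : Fin 3, twistCurv A B U 0 j.succ =O[𝓟 openDiamond] S := by
    intro j
    fin_cases j
    · exact hfield 3
    · exact hfield 4
    · exact hfield 5
  have hf : ∀ i j : Fin 3, twistCurv A B U i.succ j.succ =O[𝓟 openDiamond] S := by
    have h23 : twistCurv A B U 2 3 =O[𝓟 openDiamond] S := hfield 6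
    have h31 : twistCurv A B U 3 1 =O[𝓟 openDiamond] S := hfield 7
    have h12 : twistCurv A B U 1 2 =O[𝓟 openDiamond] S := hfield 8
    have h32 : twistCurv A B U 3 2 =O[𝓟 openDiamond] S := by rw [hsw 2 3]; exact h23.neg_left
    have h13 : twistCurv A B U 1 3 =O[𝓟 openDiamond] S := by rw [hsw 3 1]; exact h31.neg_left
    have h21 : twistCurv A B U 2 1 =O[𝓟 openDiamond] S := by rw [hsw 1 2]; exact h12.neg_left
    have hd : ∀ μ, twistCurv A B U μ μ =O[𝓟 openDiamond] S := by
      intro μ; rw [hdiag]; exact isBigO_zero _ _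
    intro i j
    fin_cases i <;> fin_cases j
    exacts [hd _, h12, h13, h21, hd _, h23, h31, h32, hd _]
  have hAc : ∀ μ, Continuous (A μ) := fun μ => (hA μ).continuous
  have hBc : ∀ μ, Continuous (B μ) := fun μ => (hB μ).continuous
  have hFA : ∀ μ ν, Continuous (curv A μ ν) := fun μ ν => (contDiff_curv hA μ ν).continuous
  have hFB : ∀ μ ν, Continuous (curv B μ ν) := fun μ ν => (contDiff_curv hB μ ν).continuous
  have hEq : ∀ {f g : Spacetime → Mat n}, (∀ z ∈ openDiamond, f z = g z) →
      g =O[𝓟 openDiamond] S → f =O[𝓟 openDiamond] S := fun h hg =>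
    hg.congr' (Filter.EventuallyEq.symm (Filter.eventually_principal.2 h)) Filter.EventuallyEq.rfl
  have hRa : ∀ i : Fin 3, (fun z => pd 0 (twistD A B i.succ U) z) =O[𝓟 openDiamond] S := by
    intro i
    refine hEq (fun z hz => pd_twistD_zero_eq hA hB hU h0 hz i.succ) ?_
    exact (hf0 i).sub (isBigO_twistMul (hAc 0) (hBc 0) (ha i))
  have hRe : ∀ j : Fin 3, (fun z => pd 0 (twistCurv A B U 0 j.succ) z
      - ∑ i : Fin 3, pd i.succ (twistCurv A B U i.succ j.succ) z) =O[𝓟 openDiamond] S := by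
    intro j
    refine hEq (fun z hz => sub_eq_of_eq_add'
      (pd_twistCurv_zero_eq hA hB hU (h0 z hz) j (hYA z hz j) (hYB z hz j))) ?_
    refine IsBigO.sub (IsBigO.sub ?_ ?_) (isBigO_twistMul (hAc 0) (hBc 0) (hf0 j))
    · exact IsBigO.fun_sum fun i _ => isBigO_twistMul (hAc _) (hBc _) (hf i j)
    · exact IsBigO.fun_sum fun i _ => isBigO_twistMul (hFA _ _) (hFB _ _) (ha i)
  have hRb : ∀ i j : Fin 3, (fun z => pd 0 (twistCurv A B U i.succ j.succ) z
      - (pd i.succ (twistCurv A B U 0 j.succ) z - pd j.succ (twistCurv A B U 0 i.succ) z))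
        =O[𝓟 openDiamond] S := by
    intro i j
    refine hEq (fun z hz => sub_eq_of_eq_add'
      (pd_twistCurv_eq hA hB hU (h0 z hz) i.succ j.succ)) ?_
    refine IsBigO.add (IsBigO.add (IsBigO.sub (IsBigO.sub ?_ ?_) ?_) ?_) ?_
    · exact isBigO_twistMul (hAc _) (hBc _) (hf0 j)
    · exact isBigO_twistMul (hAc _) (hBc _) (hf0 i)
    · exact isBigO_twistMul (hAc _) (hBc _) (hf i j)
    · exact isBigO_twistMul (hFA _ _) (hFB _ _) (ha i)
    · exact isBigO_twistMul (hFA _ _) (hFB _ _) (ha j)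
  have hpn : ∀ ρ μ ν z, pd ρ (twistCurv A B U ν μ) z = -pd ρ (twistCurv A B U μ ν) z := by
    intro ρ μ ν z
    rw [hsw μ ν, pd, fderiv_fun_neg]
    rfl
  have hp0 : ∀ ρ μ z, pd ρ (twistCurv A B U μ μ) z = 0 := by
    intro ρ μ z
    rw [hdiag, pd, fderiv_fun_const]
    rfl
  have hlowopen : IsOpen {z : Spacetime | z ∈ openDiamond ∧ z.1 + 1 - ‖z.2‖ < δ} := by
    have h1 : Continuous fun z : Spacetime => z.1 + 1 - ‖z.2‖ := by fun_prop
    exact isOpen_openDiamond.inter (isOpen_lt h1 continuous_const)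
  have hzero := eq_zero_of_maxwell (X := twistFields A B U) ?_ hδ ?_ ?_
  · intro z hz μ
    fin_cases μ
    · exact h0 z hz
    · exact hzero z hz 0
    · exact hzero z hz 1
    · exact hzero z hz 2
  · intro k
    fin_cases k
    · exact contDiff_twistD hA hB hU 1
    · exact contDiff_twistD hA hB hU 2
    · exact contDiff_twistD hA hB hU 3
    · exact contDiff_twistCurv hA hB hU 0 1
    · exact contDiff_twistCurv hA hB hU 0 2
    · exact contDiff_twistCurv hA hB hU 0 3
    · exact contDiff_twistCurv hA hB hU 2 3
    · exact contDiff_twistCurv hA hB hU 3 1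
    · exact contDiff_twistCurv hA hB hU 1 2
  · intro k
    have hred : ∀ {R : Spacetime → Mat n}, R =O[𝓟 openDiamond] S →
        (∀ z, pd 0 (twistFields A B U k) z - ![0, 0, 0,
            -pd 2 (twistCurv A B U 1 2) z + pd 3 (twistCurv A B U 3 1) z,
            pd 1 (twistCurv A B U 1 2) z + -pd 3 (twistCurv A B U 2 3) z,
            -pd 1 (twistCurv A B U 3 1) z + pd 2 (twistCurv A B U 2 3) z,
            pd 2 (twistCurv A B U 0 3) z + -pd 3 (twistCurv A B U 0 2) z,
            -pd 1 (twistCurv A B U 0 3) z + pd 3 (twistCurv A B U 0 1) z,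
            pd 1 (twistCurv A B U 0 2) z + -pd 2 (twistCurv A B U 0 1) z] k = R z) →
        (fun z => pd 0 (twistFields A B U k) z - ∑ i : Fin 3, ∑ l,
          (maxwellCoeff i k l : ℝ) • pd i.succ (twistFields A B U l) z) =O[𝓟 openDiamond] S := by
      intro R hR h
      refine hR.congr_left fun z => ?_
      rw [sum_maxwellCoeff_smul (fun i l => pd i.succ (twistFields A B U l) z) k]
      exact (h z).symm
    fin_cases k
    · exact hred (hRa 0) fun z => sub_zero _
    · exact hred (hRa 1) fun z => sub_zero _
    · exact hred (hRa 2) fun z => sub_zero _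
    · refine hred (hRe 0) fun z => congrArg₂ _ rfl ?_
      rw [Fin.sum_univ_three]
      change _ = pd 1 (twistCurv A B U 1 1) z + pd 2 (twistCurv A B U 2 1) z
        + pd 3 (twistCurv A B U 3 1) z
      rw [hp0, hpn 2 1 2, zero_add]
      rfl
    · refine hred (hRe 1) fun z => congrArg₂ _ rfl ?_
      rw [Fin.sum_univ_three]
      change _ = pd 1 (twistCurv A B U 1 2) z + pd 2 (twistCurv A B U 2 2) z
        + pd 3 (twistCurv A B U 3 2) z
      rw [hp0, hpn 3 2 3, add_zero]
      rfl
    · refine hred (hRe 2) fun z => congrArg₂ _ rfl ?_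
      rw [Fin.sum_univ_three]
      change _ = pd 1 (twistCurv A B U 1 3) z + pd 2 (twistCurv A B U 2 3) z
        + pd 3 (twistCurv A B U 3 3) z
      rw [hp0, hpn 1 3 1, add_zero]
      rfl
    · exact hred (hRb 1 2) fun z => congrArg₂ _ rfl (sub_eq_add_neg _ _).symm
    · exact hred (hRb 2 0) fun z => congrArg₂ _ rfl (neg_add_eq_sub _ _)
    · exact hred (hRb 0 1) fun z => congrArg₂ _ rfl (sub_eq_add_neg _ _).symm
  · intro z hz hzδ k
    have hD : ∀ μ, twistD A B μ U z = 0 := hlow z hz hzδ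
    -- The derivatives D_μ U vanish on an open set near the lower boundary, hence so do their
    -- commutators.
    have hF : ∀ μ ν, twistCurv A B U μ ν z = 0 := by
      intro μ ν
      rw [twistCurv_eq hA hB hU,
        twistD_eq_zero_of_eq_zero hlowopen (fun y hy => hlow y hy.1 hy.2 ν) μ ⟨hz, hzδ⟩,
        twistD_eq_zero_of_eq_zero hlowopen (fun y hy => hlow y hy.1 hy.2 μ) ν ⟨hz, hzδ⟩, sub_zero]
    fin_cases k
    exacts [hD 1, hD 2, hD 3, hF 0 1, hF 0 2, hF 0 3, hF 2 3, hF 3 1, hF 1 2]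

end Uniqueness

/-! ### Extension of smooth maps from the diamond -/

section Extension

open scoped Manifold

/-- Multiply the local extension by a smooth cutoff equal to 1 near s and to 0 near the complement
of O. After this the analysis can use functions smooth on all of space-time. -/
theorem SmoothOn.exists_contDiff {F : Type*} [NormedAddCommGroup F] [NormedSpace ℝ F]
    {s : Set Spacetime} (hs : IsClosed s) {f : Spacetime → F} (hf : SmoothOn s f) :
    ∃ g : Spacetime → F, ContDiff ℝ ∞ g ∧ EqOn f g s := by
  obtain ⟨O, g, hO, hsO, hg, hfg⟩ := hf
  obtain ⟨χ, h0, h1, -⟩ := exists_contMDiffMap_zero_one_nhds_of_isClosed 𝓘(ℝ, Spacetime) (n := ⊤)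
    hO.isClosed_compl hs (disjoint_compl_left_iff_subset.2 hsO)
  have hχ : ContDiff ℝ ∞ χ := χ.contMDiff.contDiff
  refine ⟨fun z => χ z • g z, contDiff_iff_contDiffAt.2 fun z => ?_, fun z hz => ?_⟩
  · by_cases hz : z ∈ O
    · exact hχ.contDiffAt.smul (hg.contDiffAt (hO.mem_nhds hz))
    · have h2 : (fun z => χ z • g z) =ᶠ[nhds z] fun _ => 0 := by
        filter_upwards [Filter.Eventually.filter_mono (nhds_le_nhdsSet hz) h0] with y hy
        rw [hy, zero_smul]
      exact contDiffAt_const.congr_of_eventuallyEq h2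
  · simp only [h1.self_of_nhdsSet z hz, one_smul, hfg hz]

/-- Serves to switch off the source of an ODE below the lower cone, where nothing is known about the
extended gauge. -/
theorem exists_contDiff_cutoff {δ : ℝ} (hδ : 0 < δ) : ∃ χ : Spacetime → ℝ, ContDiff ℝ ∞ χ ∧
    (∀ z, z.1 + 1 - ‖z.2‖ ≤ 0 → χ z = 0) ∧ ∀ z, δ ≤ z.1 + 1 - ‖z.2‖ → χ z = 1 := by
  have h1 : Continuous fun z : Spacetime => z.1 + 1 - ‖z.2‖ := by fun_prop
  obtain ⟨χ, hχ0, hχ1, -⟩ := exists_contMDiffMap_zero_one_of_isClosed 𝓘(ℝ, Spacetime) (n := ⊤)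
    (isClosed_le h1 continuous_const : IsClosed {z : Spacetime | z.1 + 1 - ‖z.2‖ ≤ 0})
    (isClosed_le continuous_const h1 : IsClosed {z : Spacetime | δ ≤ z.1 + 1 - ‖z.2‖})
    (Set.disjoint_left.2 fun z hz hz' => absurd (le_trans hz' hz) (not_le.2 hδ))
  exact ⟨χ, χ.contMDiff.contDiff, fun z hz => hχ0 hz, fun z hz => hχ1 hz⟩

/-- A continuous positive function on the compact set `diamond \ N` is bounded below, so a
neighbourhood of the lower boundary contains a strip of uniform width. -/
theorem exists_pos_of_lowerBoundary_subset {N : Set Spacetime} (hN : IsOpen N)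
    (hlN : lowerBoundary ⊆ N) :
    ∃ δ : ℝ, 0 < δ ∧ ∀ z ∈ diamond, z.1 + 1 - ‖z.2‖ < δ → z ∈ N := by
  have h1 : Continuous fun z : Spacetime => z.1 + 1 - ‖z.2‖ := by fun_prop
  have hpos : ∀ z ∈ diamond \ N, 0 < z.1 + 1 - ‖z.2‖ := by
    rintro z ⟨hz, hzN⟩
    refine lt_of_le_of_ne (sub_nonneg.2 hz.1) fun h => hzN (hlN ⟨hz, ?_⟩)
    linarith
  obtain ⟨δ, hδ, h⟩ := (isCompact_diamond.diff hN).exists_forall_le' h1.continuousOn hpos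
  refine ⟨δ, hδ, fun z hz hzδ => ?_⟩
  by_contra hzN
  exact absurd (h z ⟨hz, hzN⟩) (not_le.2 hzδ)

end Extension

/-! ### The temporal intertwiner -/

section Temporal

variable {n : ℕ}

/-- The inhomogeneous equation becomes linear once a second component, constantly equal to 1,
multiplies the source γ. -/
theorem exists_contDiff_affineODE_solution {a b γ : Spacetime → Mat n} (ha : ContDiff ℝ ∞ a)
    (hb : ContDiff ℝ ∞ b) (hγ : ContDiff ℝ ∞ γ) (t₀ : ℝ) :
    ∃ w : Spacetime → Mat n, ContDiff ℝ ∞ w ∧ (∀ x, w (t₀, x) = 0) ∧ ∀ t x,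
      HasDerivAt (fun r => w (r, x)) (w (t, x) * b (t, x) - a (t, x) * w (t, x) + γ (t, x)) t := by
  have : CompleteSpace (Mat n) := FiniteDimensional.complete ℝ _
  let M := ContinuousLinearMap.mul ℝ (Mat n)
  let L : Spacetime → (Mat n × ℝ) →L[ℝ] Mat n × ℝ := fun z =>
    (ContinuousLinearMap.inl ℝ (Mat n) ℝ).comp
      ((M.flip (b z) - M (a z)).comp (ContinuousLinearMap.fst ℝ (Mat n) ℝ)
        + (ContinuousLinearMap.snd ℝ (Mat n) ℝ).smulRight (γ z))
  have hL : ContDiff ℝ ∞ L :=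
    contDiff_const.clm_comp ((((M.flip.contDiff.comp hb).sub (M.contDiff.comp ha)).clm_comp
      contDiff_const).add (contDiff_const.smulRight hγ))
  obtain ⟨w, hw, hw0, hwd⟩ := exists_contDiff_linearODE_solution hL t₀ ((0, 1) : Mat n × ℝ)
  have h2 : ∀ t x, (w (t, x)).2 = 1 := by
    intro t x
    have hd : ∀ t, HasDerivAt (fun r => (w (r, x)).2) 0 t := fun t => (hwd t x).snd
    have := is_const_of_deriv_eq_zero (fun t => (hd t).differentiableAt) (fun t => (hd t).deriv)
      t t₀
    simpa [hw0] using this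
  refine ⟨fun z => (w z).1, contDiff_fst.comp hw, fun x => by simp [hw0], fun t x => ?_⟩
  have h : HasDerivAt (fun r => (w (r, x)).1) (L (t, x) (w (t, x))).1 t := (hwd t x).fst
  simpa [L, M, h2] using h

theorem eq_zero_of_hasDerivAt_mul {a b W : ℝ → Mat n} {s₀ s₁ : ℝ} (hs : s₀ ≤ s₁)
    (ha : ContinuousOn a (Icc s₀ s₁)) (hb : ContinuousOn b (Icc s₀ s₁))
    (hW : ∀ s ∈ Icc s₀ s₁, HasDerivAt W (W s * b s - a s * W s) s) (h0 : W s₀ = 0) :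
    W s₁ = 0 := by
  obtain ⟨Ma, hMa⟩ := (isCompact_Icc (a := s₀) (b := s₁)).exists_bound_of_continuousOn ha
  obtain ⟨Mb, hMb⟩ := (isCompact_Icc (a := s₀) (b := s₁)).exists_bound_of_continuousOn hb
  refine eq_zero_of_abs_deriv_le_mul_abs_self_of_eq_zero_right (K := Ma + Mb)
    (fun s hs => (hW s hs).continuousAt.continuousWithinAt)
    (fun s hs => (hW s (Ico_subset_Icc_self hs)).hasDerivWithinAt) h0 (fun s hs => ?_) s₁
    ⟨hs, le_rfl⟩
  have hs' := Ico_subset_Icc_self hs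
  calc ‖W s * b s - a s * W s‖ ≤ ‖W s * b s‖ + ‖a s * W s‖ := norm_sub_le _ _
    _ ≤ ‖W s‖ * ‖b s‖ + ‖a s‖ * ‖W s‖ := add_le_add (norm_mul_le _ _) (norm_mul_le _ _)
    _ ≤ ‖W s‖ * Mb + Ma * ‖W s‖ := by
      gcongr
      exacts [hMb s hs', hMa s hs']
    _ = (Ma + Mb) * ‖W s‖ := by ring

theorem hasDerivAt_pd_zero {f : Spacetime → Mat n} (hf : ContDiff ℝ ∞ f) (t : ℝ)
    (x : EuclideanSpace ℝ (Fin 3)) : HasDerivAt (fun r => f (r, x)) (pd 0 f (t, x)) t := by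
  have h1 : HasDerivAt (fun r : ℝ => ((r, x) : Spacetime)) (1, 0) t :=
    (hasDerivAt_id t).prodMk (hasDerivAt_const t x)
  exact (hf.differentiable (by simp) (t, x)).hasFDerivAt.comp_hasDerivAt t h1

/-- A `G`-valued map on the diamond that is covariantly constant in time near the lower boundary
agrees there with one that is covariantly constant in time throughout. -/
theorem exists_temporal_intertwiner {G : Subgroup (Matrix.GeneralLinearGroup (Fin n) ℂ)}
    (hG : IsCompact (G : Set (Matrix.GeneralLinearGroup (Fin n) ℂ)))
    {a b : Fin 4 → Spacetime → Mat n} (ha : ∀ μ, ContDiff ℝ ∞ (a μ))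
    (hb : ∀ μ, ContDiff ℝ ∞ (b μ)) (hag : ∀ z ∈ diamond, a 0 z ∈ lieAlg G)
    (hbg : ∀ z ∈ diamond, b 0 z ∈ lieAlg G) {U₀ : Spacetime → Mat n} (hU₀ : ContDiff ℝ ∞ U₀)
    (hU₀G : ∀ z ∈ diamond, U₀ z ∈ matrixSet G) {δ : ℝ} (hδ : 0 < δ)
    (hlow : ∀ z ∈ diamond, z.1 + 1 - ‖z.2‖ < δ → twistD a b 0 U₀ z = 0) :
    ∃ U : Spacetime → Mat n, ContDiff ℝ ∞ U ∧ (∀ z ∈ diamond, U z ∈ matrixSet G) ∧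
      (∀ z ∈ diamond, z.1 + 1 - ‖z.2‖ < δ → U z = U₀ z) ∧
      ∀ z ∈ diamond, twistD a b 0 U z = 0 := by
  obtain ⟨χ, hχ, hχ0, hχ1⟩ := exists_contDiff_cutoff hδ
  -- The source for the correction w in U = U₀ + w. On the diamond the cutoff is invisible, since
  -- D_0 U₀ already vanishes wherever χ may differ from 1. The initial time -1 is that of the bottom
  -- tip, so the whole diamond lies in its future.
  let γ : Spacetime → Mat n := fun z => -(χ z • twistD a b 0 U₀ z)
  have hγ : ContDiff ℝ ∞ γ := (hχ.smul (contDiff_twistD ha hb hU₀ 0)).neg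
  obtain ⟨w, hw, hw0, hwd⟩ := exists_contDiff_affineODE_solution (ha 0) (hb 0) hγ (-1)
  have hγD : ∀ z ∈ diamond, γ z = -twistD a b 0 U₀ z := by
    intro z hz
    rcases lt_or_ge (z.1 + 1 - ‖z.2‖) δ with h | h
    · simp [γ, hlow z hz h]
    · simp [γ, hχ1 z h]
  have hline : ∀ {f : Spacetime → Mat n}, ContDiff ℝ ∞ f → ∀ x (s : Set ℝ),
      ContinuousOn (fun r => f (r, x)) s := fun hf x s =>
    (hf.continuous.comp (by fun_prop : Continuous fun r : ℝ => ((r, x) : Spacetime))).continuousOn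
  have hwzero : ∀ z ∈ diamond, z.1 + 1 - ‖z.2‖ < δ → w z = 0 := by
    intro z hz hzδ
    have hn := norm_nonneg z.2
    refine eq_zero_of_hasDerivAt_mul (a := fun r => a 0 (r, z.2)) (b := fun r => b 0 (r, z.2))
      (W := fun r => w (r, z.2)) (s₀ := -1) (s₁ := z.1) (by linarith [hz.1]) (hline (ha 0) _ _)
      (hline (hb 0) _ _) (fun s hs => ?_) (hw0 _)
    -- On the vertical segment from time -1 up to z, a point lies either under the lower cone, where
    -- χ = 0, or in the strip, where U₀ is already parallel in time.
    have hγ0 : γ (s, z.2) = 0 := by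
      rcases le_total (s + 1 - ‖z.2‖) 0 with h | h
      · simp [γ, hχ0 (s, z.2) h]
      · have hsD : ((s, z.2) : Spacetime) ∈ diamond :=
          ⟨sub_nonneg.1 h, hz.2.trans (by linarith [hs.2])⟩
        rw [hγD _ hsD, hlow _ hsD (lt_of_le_of_lt (by linarith [hs.2]) hzδ), neg_zero]
    simpa [hγ0] using hwd s z.2
  have hU : ContDiff ℝ ∞ fun z => U₀ z + w z := hU₀.add hw
  have hUlow : ∀ z ∈ diamond, z.1 + 1 - ‖z.2‖ < δ → U₀ z + w z = U₀ z := fun z hz hzδ => by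
    rw [hwzero z hz hzδ, add_zero]
  have hUD : ∀ z ∈ diamond, twistD a b 0 (fun z => U₀ z + w z) z = 0 := by
    intro z hz
    have h1 : pd 0 w z = w z * b 0 z - a 0 z * w z + γ z :=
      (hasDerivAt_pd_zero hw z.1 z.2).unique (hwd z.1 z.2)
    rw [hγD z hz] at h1
    simp only [twistD] at h1 ⊢
    rw [pd_add hU₀ hw, h1]
    noncomm_ring
  refine ⟨_, hU, fun z hz => ?_, hUlow, hUD⟩
  -- Membership in G is propagated from the lower boundary, met at time |x| - 1, where U = U₀; below
  -- it neither U₀ nor the coefficients are controlled.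
  have hD : ∀ s ∈ Icc (‖z.2‖ - 1) z.1, ((s, z.2) : Spacetime) ∈ diamond := fun s hs =>
    ⟨by linarith [hs.1], hz.2.trans (by linarith [hs.2])⟩
  have hle : ‖z.2‖ - 1 ≤ z.1 := by linarith [hz.1]
  refine mem_matrixSet_of_hasDerivAt hG (a := fun r => a 0 (r, z.2)) (b := fun r => b 0 (r, z.2))
    (W := fun r => U₀ (r, z.2) + w (r, z.2)) hle (hline (ha 0) _ _) (hline (hb 0) _ _)
    (fun s hs => hag _ (hD s hs)) (fun s hs => hbg _ (hD s hs)) (fun s hs => ?_) ?_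
  · have h1 := hasDerivAt_pd_zero hU s z.2
    have h2 : pd 0 (fun z => U₀ z + w z) (s, z.2) = (U₀ (s, z.2) + w (s, z.2)) * b 0 (s, z.2)
        - a 0 (s, z.2) * (U₀ (s, z.2) + w (s, z.2)) := by
      have h3 := hUD _ (hD s hs)
      rw [twistD, add_eq_zero_iff_eq_neg, neg_sub] at h3
      exact h3
    rwa [h2] at h1
  · have h1 := hD _ (left_mem_Icc.2 hle)
    simp only [hUlow _ h1 (by simpa using hδ)]
    exact hU₀G _ h1

end Temporal

/-! ### Gauge equivalence -/

section GaugeEquivalence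

variable {n : ℕ}

theorem sum_coords_smul_coordVec (v : Spacetime) : ∑ μ, coords v μ • coordVec μ = v := by
  rw [Fin.sum_univ_succ]
  simp only [coords, coordVec, Fin.cons_zero, Fin.cons_succ]
  refine Prod.ext (by simp [Prod.fst_sum]) ?_
  ext i
  simp [Prod.snd_sum, Pi.single_apply]

/-- Multiplication by U removes the inverse and leaves a condition linear in U, which can be tested
on the coordinate vectors. -/
theorem gaugeRelatedAt_iff {g : Spacetime → Matrix.GeneralLinearGroup (Fin n) ℂ}
    {A B A' B' : Spacetime → Spacetime →L[ℝ] Mat n} {U : Spacetime → Mat n}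
    (hU : ContDiff ℝ ∞ U) (hgU : EqOn (fun z => (g z : Mat n)) U diamond)
    (hA : EqOn A A' diamond) (hB : EqOn B B' diamond) {z : Spacetime} (hz : z ∈ diamond) :
    GaugeRelatedAt g A B z ↔ ∀ μ, twistD (component A') (component B') μ U z = 0 := by
  have hd : fderivWithin ℝ (fun y => (g y : Mat n)) diamond z = fderiv ℝ U z := by
    rw [fderivWithin_congr hgU (hgU hz)]
    exact (hU.differentiable (by simp) z).fderivWithin (uniqueDiffOn_diamond z hz)
  have hgz : (g z : Mat n) = U z := hgU hz
  have hiff : ∀ v, (B z v =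
      ((g z)⁻¹ : Matrix.GeneralLinearGroup (Fin n) ℂ) *
          fderivWithin ℝ (fun y => (g y : Mat n)) diamond z v
        + ((g z)⁻¹ : Matrix.GeneralLinearGroup (Fin n) ℂ) * A z v * (g z : Mat n)) ↔
      fderiv ℝ U z v + (A' z v * U z - U z * B' z v) = 0 := by
    intro v
    rw [hd, hA hz, hB hz, mul_assoc, ← mul_add, eq_comm, Units.inv_mul_eq_iff_eq_mul, hgz,
      ← sub_eq_zero, add_sub_assoc]
  refine ⟨fun h μ => (hiff _).1 (h (coordVec μ)), fun h v => (hiff v).2 ?_⟩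
  have h' : ∀ μ, fderiv ℝ U z (coordVec μ)
      + (A' z (coordVec μ) * U z - U z * B' z (coordVec μ)) = 0 := h
  rw [← sum_coords_smul_coordVec v]
  simp only [map_sum, map_smul, Finset.sum_mul, Finset.mul_sum, ← Finset.sum_sub_distrib,
    ← Finset.sum_add_distrib, smul_mul_assoc, mul_smul_comm, ← smul_sub, ← smul_add, h',
    smul_zero, Finset.sum_const_zero]

theorem basePoint_mem_lowerBoundary : basePoint ∈ lowerBoundary := by
  simp [lowerBoundary, diamond, basePoint]

/-- Yang–Mills connections that are gauge equivalent near the lower boundary of the diamond are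
gauge equivalent in the diamond. -/
theorem GaugeEquivNearLower.gaugeEquiv {G : Subgroup (Matrix.GeneralLinearGroup (Fin n) ℂ)}
    (hG : IsCompact (G : Set (Matrix.GeneralLinearGroup (Fin n) ℂ)))
    {A B : Spacetime → Spacetime →L[ℝ] Mat n} (hA : IsConnection G A) (hB : IsConnection G B)
    (hYMA : SolvesYangMills A) (hYMB : SolvesYangMills B) (hAB : GaugeEquivNearLower G A B) :
    GaugeEquiv G A B := by
  obtain ⟨g₀, ⟨hg₀s, hg₀G, hg₀p⟩, N, hN, hlN, hrel⟩ := hAB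
  obtain ⟨A', hA's, hAA'⟩ := hA.1.exists_contDiff isClosed_diamond
  obtain ⟨B', hB's, hBB'⟩ := hB.1.exists_contDiff isClosed_diamond
  obtain ⟨U₀, hU₀, hgU₀⟩ := hg₀s.exists_contDiff isClosed_diamond
  obtain ⟨δ, hδ, hδN⟩ := exists_pos_of_lowerBoundary_subset hN hlN
  have ha := contDiff_component hA's
  have hb := contDiff_component hB's
  have hlow₀ : ∀ z ∈ diamond, z.1 + 1 - ‖z.2‖ < δ →
      ∀ μ, twistD (component A') (component B') μ U₀ z = 0 := fun z hz hzδ =>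
    (gaugeRelatedAt_iff hU₀ hgU₀ hAA' hBB' hz).1 (hrel z ⟨hδN z hz hzδ, hz⟩)
  obtain ⟨U, hU, hUG, hUU₀, hU0⟩ := exists_temporal_intertwiner hG ha hb
    (fun z hz => by rw [component, ← hAA' hz]; exact hA.2 z hz _)
    (fun z hz => by rw [component, ← hBB' hz]; exact hB.2 z hz _) hU₀
    (fun z hz => ⟨g₀ z, hg₀G z hz, hgU₀ hz⟩) hδ (fun z hz hzδ => hlow₀ z hz hzδ 0)
  have hlow : ∀ z ∈ openDiamond, z.1 + 1 - ‖z.2‖ < δ →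
      ∀ μ, twistD (component A') (component B') μ U z = 0 := by
    intro z hz hzδ μ
    have h1 : Continuous fun z : Spacetime => z.1 + 1 - ‖z.2‖ := by fun_prop
    have hev : U =ᶠ[nhds z] U₀ := by
      filter_upwards [isOpen_openDiamond.mem_nhds hz,
        (isOpen_lt h1 continuous_const).mem_nhds hzδ] with y hy hyδ
      exact hUU₀ y (openDiamond_subset_diamond hy) hyδ
    rw [← hlow₀ z (openDiamond_subset_diamond hz) hzδ μ]
    simp only [twistD, pd, hev.fderiv_eq, hev.eq_of_nhds]
  have hopen := twistD_eq_zero ha hb hU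
    (fun z hz j => hYMA.component_eq hA's hAA' (openDiamond_subset_diamond hz) j)
    (fun z hz j => hYMB.component_eq hB's hBB' (openDiamond_subset_diamond hz) j)
    (fun z hz => hU0 z (openDiamond_subset_diamond hz)) hδ hlow
  have hall : ∀ z ∈ diamond, ∀ μ, twistD (component A') (component B') μ U z = 0 := fun z hz μ =>
    (isClosed_eq (contDiff_twistD ha hb hU μ).continuous continuous_const).closure_subset_iff.2
      (fun y hy => hopen y hy μ) (diamond_subset_closure_openDiamond hz)
  -- Off the diamond U need not be invertible, so an arbitrary group element is used there.
  have hex : ∀ z, ∃ g : Matrix.GeneralLinearGroup (Fin n) ℂ,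
      z ∈ diamond → g ∈ G ∧ (g : Mat n) = U z := by
    intro z
    by_cases hz : z ∈ diamond
    · obtain ⟨g, hg, hgz⟩ := hUG z hz
      exact ⟨g, fun _ => ⟨hg, hgz⟩⟩
    · exact ⟨1, fun h => absurd h hz⟩
  choose g hg using hex
  have hgU : EqOn (fun z => (g z : Mat n)) U diamond := fun z hz => (hg z hz).2
  refine ⟨g, ⟨⟨univ, U, isOpen_univ, subset_univ _, hU.contDiffOn, hgU⟩, fun z hz => (hg z hz).1,
    Units.ext ?_⟩, fun z hz => (gaugeRelatedAt_iff hU hgU hAA' hBB' hz).2 (hall z hz)⟩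
  -- The tip lies on the lower boundary, where U still equals U₀; this preserves the normalisation
  -- at p.
  have hp := basePoint_mem_lowerBoundary
  have hpδ : basePoint.1 + 1 - ‖basePoint.2‖ < δ := by simpa [basePoint] using hδ
  have h1 : U₀ basePoint = 1 := by
    rw [← hgU₀ hp.1]
    simp [hg₀p]
  rw [(hg _ hp.1).2, hUU₀ _ hp.1 hpδ, h1, Units.val_one]

end GaugeEquivalence

end YangMills

open YangMills in
theorem mainTheorem6 (n : ℕ) (G : Subgroup (Matrix.GeneralLinearGroup (Fin n) ℂ))
    (hcompact : IsCompact (G : Set (Matrix.GeneralLinearGroup (Fin n) ℂ)))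
    (hconn : IsConnected (G : Set (Matrix.GeneralLinearGroup (Fin n) ℂ)))
    (A B : Spacetime → Spacetime →L[ℝ] Mat n)
    (hA : IsConnection G A) (hB : IsConnection G B)
    (hYMA : SolvesYangMills A) (hYMB : SolvesYangMills B)
    (hAB : GaugeEquivNearLower G A B) :
    GaugeEquiv G A B := by
  exact hAB.gaugeEquiv hcompact hA hB hYMA hYMB
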